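/- Let $K$ be a field, $x\in K$ and $k\ge 0$ an integer. A Motzkin $k$-diagram consists of two rows of $k$ vertices (top and bottom), each vertex being joined to at most one other vertex by an edge, such that the edges can be drawn without crossings inside the rectangle formed by the vertices. The Motzkin algebra $\mathsf{M}_k(x)$ is the $K$-vector space with basis the Motzkin $k$-diagrams, with the bilinear multiplication determined on diagrams as follows: place $d_1$ above $d_2$ and identify the bottom row of $d_1$ with the top row of $d_2$; then $d_1d_2=x^{\kappa(d_1,d_2)}d_3$, where $\kappa(d_1,d_2)$ is the number of closed loops that arise in the middle row, and $d_3$ is the diagram on the top row of $d_1$ and the bottom row of $d_2$ in which two vertices are joined exactly when they are connected by a path in the stacked picture. (Paths that end at an isolated vertex of the middle row are deleted without a factor, and their other end becomes isolated.) Its identity element is the diagram joining each top vertex to the vertex below it; in particular $\mathsf{M}_0(x)=K$. Let $u_j$ be the rescaled Chebyshev polynomials of the second kind, $u_0(t)=1$, $u_1(t)=t$, $u_j(t)=t\,u_{j-1}(t)-u_{j-2}(t)$ for $j\ge 2$ (so that $u_j(t)=U_j(t/2)$). Then $\mathsf{M}_k(x)$ is a semisimple algebra if and only if $u_j(x-1)\neq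 0$ in $K$ for all integers $j$ with $1\le j\le k-1$. -/

import Mathlib

/-- A partial matching on `V` (every vertex is joined to at most one other vertex by an edge),
encoded by the involution that sends a vertex to the other end of its edge and fixes exactly
the isolated vertices. -/
structure Matching (V : Type*) where
  /-- The other end of the edge at `v`, or `v` itself if `v` is isolated. -/
  partner : V → V
  invol : ∀ v, partner (partner v) = v

namespace Matching

section basics

variable {V W : Type*} [DecidableEq V] [DecidableEq W]

theorem ext_partner {V : Type*} {f g : Matching V} (h : ∀ v, f.partner v = g.partner v) :
    f = g := by
  cases f; cases g; congr; funext v; exact h v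

/-- The disjoint union of two matchings. -/
def sum {V W : Type*} (f : Matching V) (g : Matching W) : Matching (V ⊕ W) where
  partner := Sum.map f.partner g.partner
  invol := by rintro (v | v) <;> simp [f.invol, g.invol]

/-- The effect on edges of identifying the vertices `a` and `b` and then deleting the resulting
interior vertex: `a` and `b` carry no edge any more; if `a` was joined to `u` and `b` to `w`, then
`u` and `w` become joined; if `a` was isolated and `b` was joined to `w`, then `w` becomes
isolated, and likewise with `a` and `b` exchanged; if `a` was joined to `b`, the closed loop
disappears; all other edges are kept. -/
def glueFun (f : V → V) (a b v : V) : V :=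
  if v = a ∨ v = b then v
  else if f v = a then (if f b = b then v else f b)
  else if f v = b then (if f a = a then v else f a)
  else f v

/-- Glue the vertices `a` and `b` of a matching, see `glueFun`. -/
def glue (f : Matching V) (a b : V) : Matching V where
  partner := glueFun f.partner a b
  invol := by
    have h := f.invol
    intro v
    unfold glueFun
    grind

/-- Glue, one after the other, all the pairs of vertices in a list. -/
def glueList : List (V × V) → Matching V → Matching V
  | [], f => f
  | p :: L, f => glueList L (f.glue p.1 p.2)

/-- The number of closed loops that arise when `a` and `b` are glued: a loop arises exactly when
`a` and `b` are the two ends of one edge. -/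
def loop (f : Matching V) (a b : V) : ℕ := if f.partner a = b then 1 else 0

/-- The number of closed loops that arise while the pairs in a list are glued one after the
other. -/
def loops : List (V × V) → Matching V → ℕ
  | [], _ => 0
  | p :: L, f => f.loop p.1 p.2 + loops L (f.glue p.1 p.2)

theorem glue_comm (f : Matching V) (a b c d : V) (h1 : a ≠ c) (h2 : a ≠ d) (h3 : b ≠ c)
    (h4 : b ≠ d) : (f.glue a b).glue c d = (f.glue c d).glue a b := by
  apply ext_partner
  have h := f.invol
  intro v
  simp only [glue]
  unfold glueFun
  grind

theorem glue_symm (f : Matching V) (a b : V) : f.glue a b = f.glue b a := by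
  apply ext_partner
  have h := f.invol
  intro v
  simp only [glue]
  unfold glueFun
  grind

theorem loop_comm (f : Matching V) (a b c d : V) (h1 : a ≠ c) (h2 : a ≠ d) (h3 : b ≠ c)
    (h4 : b ≠ d) (h5 : a ≠ b) (h6 : c ≠ d) :
    f.loop a b + (f.glue a b).loop c d = f.loop c d + (f.glue c d).loop a b := by
  have h := f.invol
  simp only [glue, loop]
  unfold glueFun
  grind

theorem glue_fixed (f : Matching V) (a b v : V) (hv : f.partner v = v) :
    (f.glue a b).partner v = v := by
  have h := f.invol
  simp only [glue]
  unfold glueFun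
  grind

theorem glueList_fixed (L : List (V × V)) (f : Matching V) (v : V) (hv : f.partner v = v) :
    (glueList L f).partner v = v := by
  induction L generalizing f with
  | nil => exact hv
  | cons p L ih => exact ih _ (glue_fixed f _ _ v hv)

theorem glueList_mem_fixed (L : List (V × V)) (f : Matching V) (p : V × V) (hp : p ∈ L) :
    (glueList L f).partner p.1 = p.1 ∧ (glueList L f).partner p.2 = p.2 := by
  induction L generalizing f with
  | nil => simp at hp
  | cons q L ih =>
    rcases List.mem_cons.1 hp with rfl | h
    · rw [glueList]
      constructor <;> refine glueList_fixed L _ _ ?_ <;> simp [glue, glueFun]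
    · exact ih _ h

theorem glueList_of_notMem (L : List (V × V)) (f : Matching V) (v : V)
    (h : ∀ p ∈ L, p.1 ≠ v ∧ p.2 ≠ v ∧ p.1 ≠ f.partner v ∧ p.2 ≠ f.partner v) :
    (glueList L f).partner v = f.partner v := by
  induction L generalizing f with
  | nil => rfl
  | cons q L ih =>
    have hq := h q (by simp)
    have e : (f.glue q.1 q.2).partner v = f.partner v := by
      simp only [glue]
      unfold glueFun
      grind
    have := ih (f.glue q.1 q.2) (by
      intro p hp
      rw [e]
      exact h p (by simp [hp]))
    rw [glueList, this, e]

theorem glueList_append (L M : List (V × V)) (f : Matching V) :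
    glueList (L ++ M) f = glueList M (glueList L f) := by
  induction L generalizing f with
  | nil => rfl
  | cons p L ih => exact ih _

theorem loops_append (L M : List (V × V)) (f : Matching V) :
    loops (L ++ M) f = loops L f + loops M (glueList L f) := by
  induction L generalizing f with
  | nil => simp [loops, glueList]
  | cons p L ih => simp only [List.cons_append, loops, ih, glueList]; omega

/-- Two pairs of vertices made of four different vertices. -/
def DisjPair {V : Type*} (p q : V × V) : Prop :=
  p.1 ≠ q.1 ∧ p.1 ≠ q.2 ∧ p.2 ≠ q.1 ∧ p.2 ≠ q.2 ∧ p.1 ≠ p.2 ∧ q.1 ≠ q.2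

theorem glueList_glue (M : List (V × V)) (f : Matching V) (p : V × V)
    (h : ∀ q ∈ M, DisjPair p q) :
    glueList M (f.glue p.1 p.2) = (glueList M f).glue p.1 p.2 ∧
    f.loop p.1 p.2 + loops M (f.glue p.1 p.2) =
      loops M f + (glueList M f).loop p.1 p.2 := by
  induction M generalizing f with
  | nil => simp [glueList, loops]
  | cons q M ih =>
    obtain ⟨h1, h2, h3, h4, h5, h6⟩ := h q (by simp)
    have hc := glue_comm f p.1 p.2 q.1 q.2 h1 h2 h3 h4
    have hl := loop_comm f p.1 p.2 q.1 q.2 h1 h2 h3 h4 h5 h6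
    have := ih (f.glue q.1 q.2) (fun q' hq' => h q' (by simp [hq']))
    simp only [glueList, loops, hc]
    refine ⟨this.1, ?_⟩
    have := this.2
    omega

theorem glueList_swap (L M : List (V × V)) (f : Matching V)
    (h : ∀ p ∈ L, ∀ q ∈ M, DisjPair p q) :
    glueList (L ++ M) f = glueList (M ++ L) f ∧ loops (L ++ M) f = loops (M ++ L) f := by
  induction L generalizing f with
  | nil => simp
  | cons p L ih =>
    have h1 := ih (f.glue p.1 p.2) (fun p' hp' => h p' (by simp [hp']))
    have h2 := glueList_glue M f p (h p (by simp))
    simp only [List.cons_append, glueList, loops, h1.1, h1.2]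
    simp only [glueList_append, loops_append, glueList, loops, h2.1, true_and]
    have := h2.2
    omega

theorem glue_map (e : V → W) (he : Function.Injective e) (f : Matching V) (F : Matching W)
    (hF : ∀ v, F.partner (e v) = e (f.partner v)) (a b v : V) :
    (F.glue (e a) (e b)).partner (e v) = e ((f.glue a b).partner v) := by
  simp only [glue, glueFun, hF, he.eq_iff]
  split_ifs <;> rfl

theorem glueList_map (e : V → W) (he : Function.Injective e) (L : List (V × V))
    (f : Matching V) (F : Matching W) (hF : ∀ v, F.partner (e v) = e (f.partner v)) :
    (∀ v, (glueList (L.map (Prod.map e e)) F).partner (e v) = e ((glueList L f).partner v)) ∧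
    loops (L.map (Prod.map e e)) F = loops L f := by
  induction L generalizing f F with
  | nil => exact ⟨hF, rfl⟩
  | cons p L ih =>
    have := ih _ _ (glue_map e he f F hF p.1 p.2)
    simp only [List.map_cons, glueList, loops, loop, Prod.map_fst, Prod.map_snd, hF, he.eq_iff]
    exact ⟨this.1, by rw [this.2]⟩

/-- No two edges `u — f u` and `v — f v` cross when the vertices are placed on a line according to
`pos` and all edges are drawn on one side of the line. -/
def IsPlanar {V : Type*} (pos : V → ℕ) (f : V → V) : Prop :=
  ∀ u v, ¬ (pos u < pos v ∧ pos v < pos (f u) ∧ pos (f u) < pos (f v))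

theorem glue_planar (pos : V → ℕ) (hpos : Function.Injective pos) (f : Matching V)
    (hf : IsPlanar pos f.partner) (a b : V) (hab : pos a < pos b)
    (hb : ∀ v, pos a < pos v → pos v < pos b → f.partner v = v) :
    IsPlanar pos (f.glue a b).partner := by
  have h := f.invol
  have hne : ∀ v w, v ≠ w → pos v ≠ pos w := fun v w hvw e => hvw (hpos e)
  have out : ∀ v, v ≠ a → v ≠ b → f.partner v ≠ v → pos v < pos a ∨ pos b < pos v := by
    intro v h1 h2 h3
    have := hb v
    have := hne v a h1
    have := hne v b h2
    grind
  have H : ∀ u v u' v', f.partner u = u' → f.partner v = v' →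
      ¬ (pos u < pos v ∧ pos v < pos u' ∧ pos u' < pos v') := by
    rintro u v _ _ rfl rfl; exact hf u v
  intro u v
  simp only [glue]
  rintro ⟨h1, h2, h3⟩
  have hu : f.partner u ≠ u := by
    intro e
    simp only [glueFun, e] at h1 h2
    grind
  have hv : f.partner v ≠ v := by
    intro e
    simp only [glueFun, e] at h1 h2 h3
    grind
  have hba : b ≠ a := by rintro rfl; omega
  have hua : u ≠ a := by rintro rfl; simp [glueFun] at h1 h2; omega
  have hub : u ≠ b := by rintro rfl; simp [glueFun] at h1 h2; omega
  have hva : v ≠ a := by rintro rfl; simp [glueFun] at h2 h3; omega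
  have hvb : v ≠ b := by rintro rfl; simp [glueFun] at h2 h3; omega
  have ou := out u hua hub hu
  have ov := out v hva hvb hv
  have ou' := fun x y => out (f.partner u) x y (by rw [h]; exact hu.symm)
  have ov' := fun x y => out (f.partner v) x y (by rw [h]; exact hv.symm)
  simp only [glueFun, hua, hub, hva, hvb, or_self, if_false] at h1 h2 h3
  by_cases c1 : f.partner u = a
  · have c2 : f.partner a = u := by rw [← c1, h]
    by_cases c3 : f.partner b = b
    · simp [c1, c3] at h2; omega
    simp only [c1, c3, if_true, if_false] at h2 h3
    obtain ⟨w, hw⟩ : ∃ w, f.partner b = w := ⟨_, rfl⟩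
    have hw' : f.partner w = b := by rw [← hw, h]
    rw [hw] at h2 h3
    have ow := out w (by grind) (by grind) (by grind)
    obtain ⟨t, ht⟩ : ∃ t, f.partner v = t := ⟨_, rfl⟩
    have ht' : f.partner t = v := by rw [← ht, h]
    rw [ht] at h3 ov'
    have := H u v a t c1 ht
    have := H v u t a ht c1
    have := H t a v u ht' c2
    have := H b v w t hw ht
    have := H w v b t hw' ht
    have := H v w t b ht hw'
    have := H v b t w ht hw
    have := H a v u t c2 ht
    have := H v a t u ht c2
    grind
  by_cases d1 : f.partner u = b
  · have c2 : f.partner b = u := by rw [← d1, h]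
    by_cases c3 : f.partner a = a
    · simp [hba, d1, c3] at h2; omega
    simp only [hba, d1, c3, if_true, if_false] at h2 h3
    obtain ⟨w, hw⟩ : ∃ w, f.partner a = w := ⟨_, rfl⟩
    have hw' : f.partner w = a := by rw [← hw, h]
    rw [hw] at h2 h3
    have ow := out w (by grind) (by grind) (by grind)
    obtain ⟨t, ht⟩ : ∃ t, f.partner v = t := ⟨_, rfl⟩
    have ht' : f.partner t = v := by rw [← ht, h]
    rw [ht] at h3 ov'
    have := H u v b t d1 ht
    have := H v u t b ht d1
    have := H t b v u ht' c2
    have := H a v w t hw ht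
    have := H w v a t hw' ht
    have := H v w t a ht hw'
    have := H v a t w ht hw
    have := H b v u t c2 ht
    have := H v b t u ht c2
    grind
  by_cases e1 : f.partner v = a
  · have c2 : f.partner a = v := by rw [← e1, h]
    by_cases c3 : f.partner b = b
    · simp only [c1, d1, c3, e1, if_true, if_false] at h2 h3; omega
    simp only [c1, d1, e1, c3, if_true, if_false] at h2 h3
    obtain ⟨w, hw⟩ : ∃ w, f.partner b = w := ⟨_, rfl⟩
    have hw' : f.partner w = b := by rw [← hw, h]
    rw [hw] at h3
    have ow := out w (by grind) (by grind) (by grind)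
    obtain ⟨t, ht⟩ : ∃ t, f.partner u = t := ⟨_, rfl⟩
    rw [ht] at h2 h3 ou'
    have := H u v t a ht e1
    have := H u a t v ht c2
    have := H u b t w ht hw
    have := H u w t b ht hw'
    have := H a u v t c2 ht
    have := H b u w t hw ht
    grind
  by_cases f1 : f.partner v = b
  · have c2 : f.partner b = v := by rw [← f1, h]
    by_cases c3 : f.partner a = a
    · simp only [c1, d1, c3, f1, hba, if_true, if_false] at h2 h3; omega
    simp only [c1, d1, f1, hba, c3, if_true, if_false] at h2 h3
    obtain ⟨w, hw⟩ : ∃ w, f.partner a = w := ⟨_, rfl⟩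
    have hw' : f.partner w = a := by rw [← hw, h]
    rw [hw] at h3
    have ow := out w (by grind) (by grind) (by grind)
    obtain ⟨t, ht⟩ : ∃ t, f.partner u = t := ⟨_, rfl⟩
    rw [ht] at h2 h3 ou'
    have := H u v t b ht f1
    have := H u b t v ht c2
    have := H u a t w ht hw
    have := H u w t a ht hw'
    have := H b u v t c2 ht
    have := H a u w t hw ht
    grind
  simp only [c1, d1, e1, f1, if_false] at h2 h3
  exact hf u v ⟨h1, h2, h3⟩

theorem glueList_planar (pos : V → ℕ) (hpos : Function.Injective pos) (L : List (V × V))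
    (f : Matching V) (hf : IsPlanar pos f.partner)
    (hL : ∀ L₁ p L₂, L = L₁ ++ p :: L₂ → pos p.1 < pos p.2 ∧
      ∀ v, pos p.1 < pos v → pos v < pos p.2 →
        f.partner v = v ∨ ∃ q ∈ L₁, v = q.1 ∨ v = q.2) :
    IsPlanar pos (glueList L f).partner := by
  induction L generalizing f with
  | nil => exact hf
  | cons p L ih =>
    have h0 := hL [] p L rfl
    refine ih _ (glue_planar pos hpos f hf p.1 p.2 h0.1 fun v h1 h2 => ?_) ?_
    · simpa using h0.2 v h1 h2
    · rintro L₁ q L₂ rfl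
      have h1 := hL (p :: L₁) q L₂ rfl
      refine ⟨h1.1, fun v hv hv' => ?_⟩
      rcases h1.2 v hv hv' with h | ⟨r, hr, h⟩
      · exact Or.inl (glue_fixed f _ _ v h)
      · rcases List.mem_cons.1 hr with rfl | hr
        · left
          simp [glue, glueFun, h]
        · exact Or.inr ⟨r, hr, h⟩

end basics

section rows

variable {k : ℕ}

/-- The inclusion of the outer vertices (top row of the upper diagram, bottom row of the lower
diagram) into the vertices of two stacked diagrams. -/
def outer : Fin k ⊕ Fin k → (Fin k ⊕ Fin k) ⊕ (Fin k ⊕ Fin k) := Sum.map Sum.inl Sum.inr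

/-- The left inverse of `outer`; its values on the vertices of the middle rows are irrelevant. -/
def unouter : (Fin k ⊕ Fin k) ⊕ (Fin k ⊕ Fin k) → Fin k ⊕ Fin k :=
  Sum.map (Sum.elim id id) (Sum.elim id id)

variable (k) in
/-- The pairs (`i`-th vertex in the bottom row of the upper diagram, `i`-th vertex in the top row
of the lower diagram), which are identified when two diagrams are stacked. -/
def midPairs : List (((Fin k ⊕ Fin k) ⊕ (Fin k ⊕ Fin k)) × ((Fin k ⊕ Fin k) ⊕ (Fin k ⊕ Fin k))) :=
  (List.finRange k).map fun i => (Sum.inl (Sum.inr i), Sum.inr (Sum.inl i))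

/-- `d₁` placed above `d₂`, with the two middle rows identified. -/
def stack (d₁ d₂ : Matching (Fin k ⊕ Fin k)) : Matching ((Fin k ⊕ Fin k) ⊕ (Fin k ⊕ Fin k)) :=
  glueList (midPairs k) (d₁.sum d₂)

theorem outer_injective : Function.Injective (outer (k := k)) := by
  rintro (i | i) (j | j) h <;> simp_all [outer]

theorem stack_outer (d₁ d₂ : Matching (Fin k ⊕ Fin k)) (v : Fin k ⊕ Fin k) :
    (stack d₁ d₂).partner (outer v) = outer (unouter ((stack d₁ d₂).partner (outer v))) := by
  have key : ∀ i : Fin k, (stack d₁ d₂).partner (Sum.inl (Sum.inr i)) = Sum.inl (Sum.inr i) ∧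
      (stack d₁ d₂).partner (Sum.inr (Sum.inl i)) = Sum.inr (Sum.inl i) := fun i =>
    glueList_mem_fixed (midPairs k) (d₁.sum d₂) (Sum.inl (Sum.inr i), Sum.inr (Sum.inl i))
      (by simp [midPairs])
  have inv := (stack d₁ d₂).invol (outer v)
  rcases hw : (stack d₁ d₂).partner (outer v) with (i | i) | (i | i)
  · simp [outer, unouter]
  · rw [hw, (key i).1] at inv
    rcases v with v | v <;> simp [outer] at inv
  · rw [hw, (key i).2] at inv
    rcases v with v | v <;> simp [outer] at inv
  · simp [outer, unouter]

/-- The matching of outer vertices induced by stacking `d₁` above `d₂`. -/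
def comp (d₁ d₂ : Matching (Fin k ⊕ Fin k)) : Matching (Fin k ⊕ Fin k) where
  partner v := unouter ((stack d₁ d₂).partner (outer v))
  invol v := by
    rw [← stack_outer, (stack d₁ d₂).invol]
    rcases v with v | v <;> simp [outer, unouter]

/-- The number of closed loops that arise in the middle row when `d₁` is stacked above `d₂`. -/
def loopNumber (d₁ d₂ : Matching (Fin k ⊕ Fin k)) : ℕ := loops (midPairs k) (d₁.sum d₂)

theorem stack_partner_outer (d₁ d₂ : Matching (Fin k ⊕ Fin k)) (v : Fin k ⊕ Fin k) :
    (glueList (midPairs k) (d₁.sum d₂)).partner (outer v) = outer ((comp d₁ d₂).partner v) :=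
  stack_outer d₁ d₂ v

theorem comp_assoc_aux (d₁ d₂ d₃ : Matching (Fin k ⊕ Fin k)) :
    comp (comp d₁ d₂) d₃ = comp d₁ (comp d₂ d₃) ∧
    loopNumber d₁ d₂ + loopNumber (comp d₁ d₂) d₃ =
      loopNumber d₂ d₃ + loopNumber d₁ (comp d₂ d₃) := by
  let P := Fin k ⊕ Fin k
  let F := (d₁.sum d₂).sum d₃
  let e₁₂ : P ⊕ P → (P ⊕ P) ⊕ P := Sum.inl
  let e₂₃ : P ⊕ P → (P ⊕ P) ⊕ P := Sum.map Sum.inr id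
  let f₁ : P ⊕ P → (P ⊕ P) ⊕ P := Sum.map outer id
  let f₂ : P ⊕ P → (P ⊕ P) ⊕ P := Sum.elim (Sum.inl ∘ Sum.inl) (e₂₃ ∘ outer)
  have i₁₂ : Function.Injective e₁₂ := Sum.inl_injective
  have i₂₃ : Function.Injective e₂₃ := Sum.inr_injective.sumMap Function.injective_id
  have if₁ : Function.Injective f₁ := outer_injective.sumMap Function.injective_id
  have if₂ : Function.Injective f₂ := by
    rintro ((i | i) | (i | i)) ((j | j) | (j | j)) h <;> simp_all [f₂, e₂₃, outer]
  let L₁₂ := (midPairs k).map (Prod.map e₁₂ e₁₂)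
  let L₂₃ := (midPairs k).map (Prod.map e₂₃ e₂₃)
  have hL₂₃ : L₂₃ = (midPairs k).map (Prod.map f₁ f₁) := by
    simp [L₂₃, midPairs, e₂₃, f₁, outer, Function.comp_def]
  have hL₁₂ : L₁₂ = (midPairs k).map (Prod.map f₂ f₂) := by
    simp [L₁₂, midPairs, e₁₂, e₂₃, f₂, outer, Function.comp_def]
  have A₁ := glueList_map e₁₂ i₁₂ (midPairs k) (d₁.sum d₂) F (fun v => rfl)
  have A₂ := glueList_map f₁ if₁ (midPairs k) ((comp d₁ d₂).sum d₃) (glueList L₁₂ F) (by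
    rintro (v | v)
    · exact (A₁.1 (outer v)).trans (congrArg Sum.inl (stack_partner_outer d₁ d₂ v))
    · refine (glueList_of_notMem _ _ _ ?_).trans rfl
      simp [L₁₂, midPairs, e₁₂, f₁, F, Matching.sum])
  have B₁ := glueList_map e₂₃ i₂₃ (midPairs k) (d₂.sum d₃) F (by rintro (v | v) <;> rfl)
  have B₂ := glueList_map f₂ if₂ (midPairs k) (d₁.sum (comp d₂ d₃)) (glueList L₂₃ F) (by
    rintro (v | v)
    · refine (glueList_of_notMem _ _ _ ?_).trans rfl
      simp [L₂₃, midPairs, e₂₃, f₂, F, Matching.sum]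
    · exact (B₁.1 (outer v)).trans (congrArg e₂₃ (stack_partner_outer d₂ d₃ v)))
  have sw := glueList_swap L₁₂ L₂₃ F (by
    intro p hp q hq
    simp only [L₁₂, L₂₃, midPairs, List.map_map, List.mem_map] at hp hq
    obtain ⟨i, -, rfl⟩ := hp
    obtain ⟨j, -, rfl⟩ := hq
    simp [DisjPair, e₁₂, e₂₃])
  rw [← hL₂₃] at A₂
  rw [← hL₁₂] at B₂
  rw [glueList_append, glueList_append, loops_append, loops_append] at sw
  constructor
  · apply ext_partner
    intro v
    have a := (A₂.1 (outer v)).trans (congrArg f₁ (stack_partner_outer _ _ v))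
    have b := (B₂.1 (outer v)).trans (congrArg f₂ (stack_partner_outer _ _ v))
    have hE : ∀ w : P, f₁ (outer w) = f₂ (outer w) := by rintro (w | w) <;> rfl
    rw [sw.1, hE, hE, b] at a
    exact (outer_injective (if₂ a)).symm
  · have h := sw.2
    rw [A₂.2, B₂.2, A₁.2, B₁.2] at h
    exact h

/-- The matching that joins every vertex to the vertex below it. -/
def one (k : ℕ) : Matching (Fin k ⊕ Fin k) where
  partner := Sum.swap
  invol := Sum.swap_swap

theorem glue_one_step {V W : Type*} [DecidableEq V] [DecidableEq W] (d : Matching V)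
    (F : Matching W) (e : V → W) (v₀ : V) (b c : W)
    (he : Function.Injective e) (hF : ∀ v, F.partner (e v) = e (d.partner v))
    (hb : ∀ v, e v ≠ b) (hc : ∀ v, e v ≠ c) (hbc : F.partner b = c) (hne : b ≠ c) (v : V) :
    (F.glue (e v₀) b).partner (if v = v₀ then c else e v) =
      if d.partner v = v₀ then c else e (d.partner v) := by
  have h := F.invol
  have hd := d.invol
  have hcb : F.partner c = b := by rw [← hbc, h]
  have e0 : ∀ v w, e v = e w ↔ v = w := fun v w => he.eq_iff
  simp only [glue]
  unfold glueFun
  grind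


theorem glue_one_aux (d : Matching (Fin k ⊕ Fin k))
    (F : Matching ((Fin k ⊕ Fin k) ⊕ (Fin k ⊕ Fin k)))
    (s : Fin k → Fin k ⊕ Fin k) (b c : Fin k → (Fin k ⊕ Fin k) ⊕ (Fin k ⊕ Fin k))
    (l : List (Fin k)) (hl : l.Nodup) (e : Fin k ⊕ Fin k → (Fin k ⊕ Fin k) ⊕ (Fin k ⊕ Fin k))
    (he : Function.Injective e) (hF : ∀ v, F.partner (e v) = e (d.partner v))
    (hs : Function.Injective s) (hbi : Function.Injective b) (hci : Function.Injective c)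
    (hbc' : ∀ i j, b i ≠ c j)
    (hb : ∀ i v, e v ≠ b i) (hc : ∀ i ∈ l, ∀ v, e v ≠ c i)
    (hbc : ∀ i ∈ l, F.partner (b i) = c i) :
    ∃ e' : Fin k ⊕ Fin k → (Fin k ⊕ Fin k) ⊕ (Fin k ⊕ Fin k),
      (∀ v, (glueList (l.map fun i => (e (s i), b i)) F).partner (e' v) = e' (d.partner v)) ∧
      loops (l.map fun i => (e (s i), b i)) F = 0 ∧
      (∀ i ∈ l, e' (s i) = c i) ∧ ∀ v, (∀ i ∈ l, v ≠ s i) → e' v = e v := by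
  induction l generalizing F e with
  | nil => exact ⟨e, hF, rfl, by simp, by simp⟩
  | cons i l ih =>
    rw [List.nodup_cons] at hl
    let e₁ := fun v => if v = s i then c i else e v
    have hc0 := hc i (by simp)
    have hbc0 := hbc i (by simp)
    have hinv := F.invol
    have step := glue_one_step d F e (s i) (b i) (c i) he hF (hb i) hc0 hbc0 (hbc' i i)
    have hmap : (l.map fun j => (e (s j), b j)) = l.map fun j => (e₁ (s j), b j) := by
      refine List.map_congr_left fun j hj => ?_
      have : s j ≠ s i := fun h => hl.1 (hs h ▸ hj)
      simp [e₁, this]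
    obtain ⟨e', h1, h2, h3, h4⟩ := ih (F.glue (e (s i)) (b i)) hl.2 e₁
      (by intro v w h; simp only [e₁] at h; grind [Function.Injective])
      (fun v => step v)
      (by intro j v; simp only [e₁]; split_ifs; exacts [(hbc' j i).symm, hb j v])
      (by
        intro j hj v
        simp only [e₁]
        split_ifs
        · exact fun h => hl.1 (hci h ▸ hj)
        · exact hc j (by simp [hj]) v)
      (by
        intro j hj
        have hij : i ≠ j := fun h => hl.1 (h ▸ hj)
        have h1 := hbc j (by simp [hj])
        have h2 : b j ≠ b i := fun h => hij (hbi h).symm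
        have h3 := hb j (s i)
        have h4 := hc j (by simp [hj]) (s i)
        have h5 := hbc' i j
        simp only [glue]
        unfold glueFun
        grind)
    refine ⟨e', ?_, ?_, ?_, ?_⟩
    · simpa only [List.map_cons, glueList, hmap] using h1
    · simp only [List.map_cons, loops, hmap, h2, loop, hF, hb, if_false]
    · intro j hj
      rcases List.mem_cons.1 hj with rfl | hj
      · rw [h4 (s j) (fun t ht h => hl.1 (hs h ▸ ht))]
        simp [e₁]
      · exact h3 j hj
    · intro v hv
      rw [h4 v (fun t ht => hv t (by simp [ht]))]
      simp [e₁, hv i (by simp)]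

theorem comp_one_aux (d : Matching (Fin k ⊕ Fin k)) :
    comp d (one k) = d ∧ loopNumber d (one k) = 0 := by
  obtain ⟨e, h1, h2, h3, h4⟩ := glue_one_aux d (d.sum (one k)) Sum.inr
    (fun i => Sum.inr (Sum.inl i)) (fun i => Sum.inr (Sum.inr i)) (List.finRange k)
    (List.nodup_finRange k) Sum.inl Sum.inl_injective (fun v => rfl) Sum.inr_injective
    (Sum.inr_injective.comp Sum.inl_injective) (Sum.inr_injective.comp Sum.inr_injective)
    (by simp) (by simp) (by simp) (fun i _ => rfl)
  have he : ∀ v, e v = outer v := by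
    rintro (v | v)
    · exact h4 _ (by simp)
    · exact h3 v (by simp)
  refine ⟨ext_partner fun v => outer_injective ?_, h2⟩
  rw [← stack_partner_outer, ← he, ← he]
  exact h1 v

theorem glueList_symm {V : Type*} [DecidableEq V] (L : List (V × V)) (f : Matching V) :
    glueList (L.map Prod.swap) f = glueList L f ∧ loops (L.map Prod.swap) f = loops L f := by
  induction L generalizing f with
  | nil => simp
  | cons p L ih =>
    have : f.loop p.2 p.1 = f.loop p.1 p.2 := by
      have h := f.invol
      simp only [loop]
      grind
    simp only [List.map_cons, glueList, loops, Prod.fst_swap, Prod.snd_swap, this,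
      glue_symm f p.2 p.1, ih, and_self]

theorem one_comp_aux (d : Matching (Fin k ⊕ Fin k)) :
    comp (one k) d = d ∧ loopNumber (one k) d = 0 := by
  obtain ⟨e, h1, h2, h3, h4⟩ := glue_one_aux d ((one k).sum d) Sum.inl
    (fun i => Sum.inl (Sum.inr i)) (fun i => Sum.inl (Sum.inl i)) (List.finRange k)
    (List.nodup_finRange k) Sum.inr Sum.inr_injective (fun v => rfl) Sum.inl_injective
    (Sum.inl_injective.comp Sum.inr_injective) (Sum.inl_injective.comp Sum.inl_injective)
    (by simp) (by simp) (by simp) (fun i _ => rfl)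
  have he : ∀ v, e v = outer v := by
    rintro (v | v)
    · exact h3 v (by simp)
    · exact h4 _ (by simp)
  have hm : ((List.finRange k).map fun i => ((Sum.inr (Sum.inl i) :
      (Fin k ⊕ Fin k) ⊕ (Fin k ⊕ Fin k)), (Sum.inl (Sum.inr i) :
      (Fin k ⊕ Fin k) ⊕ (Fin k ⊕ Fin k)))) = (midPairs k).map Prod.swap := by
    simp [midPairs, Function.comp_def]
  rw [hm] at h1 h2
  rw [(glueList_symm _ _).1] at h1
  rw [(glueList_symm _ _).2] at h2
  refine ⟨ext_partner fun v => outer_injective ?_, h2⟩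
  rw [← stack_partner_outer, ← he, ← he]
  exact h1 v

/-- The positions of the vertices of a diagram along the boundary of the rectangle: first the top
row from left to right, then the bottom row from right to left. -/
def pos : Fin k ⊕ Fin k → ℕ
  | Sum.inl i => i
  | Sum.inr i => 2 * k - 1 - i

/-- The positions of the vertices of two diagrams put side by side. -/
def pos₂ : (Fin k ⊕ Fin k) ⊕ (Fin k ⊕ Fin k) → ℕ
  | Sum.inl v => pos v
  | Sum.inr v => 2 * k + pos v

theorem pos_lt (v : Fin k ⊕ Fin k) : pos v < 2 * k := by
  rcases v with v | v <;> simp only [pos] <;> omega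

theorem pos_injective : Function.Injective (pos (k := k)) := by
  rintro (i | i) (j | j) h <;> simp only [pos] at h <;>
    first | (congr 1; ext; omega) | omega

theorem pos₂_injective : Function.Injective (pos₂ (k := k)) := by
  rintro (i | i) (j | j) h <;> simp only [pos₂] at h
  · rw [pos_injective h]
  · have := pos_lt i; omega
  · have := pos_lt j; omega
  · rw [pos_injective (Nat.add_left_cancel h)]

theorem one_planar : IsPlanar pos (one k).partner := by
  rintro (i | i) (j | j) <;> simp only [pos, one, Sum.swap_inl, Sum.swap_inr] <;> omega

theorem comp_planar (d₁ d₂ : Matching (Fin k ⊕ Fin k)) (h₁ : IsPlanar pos d₁.partner)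
    (h₂ : IsPlanar pos d₂.partner) : IsPlanar pos (comp d₁ d₂).partner := by
  have hsum : IsPlanar pos₂ (d₁.sum d₂).partner := by
    rintro (u | u) (v | v) <;>
      simp only [Matching.sum, Sum.map_inl, Sum.map_inr, pos₂]
    · exact h₁ u v
    · have := pos_lt (d₁.partner u); omega
    · have := pos_lt v; omega
    · have := h₂ u v; omega
  have H : IsPlanar pos₂ (stack d₁ d₂).partner := by
    refine glueList_planar pos₂ pos₂_injective _ _ hsum fun L₁ p L₂ hL => ?_
    obtain ⟨l₁, l₂', hl, rfl, h⟩ := List.map_eq_append_iff.1 hL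
    obtain ⟨i, l₂, rfl, rfl, rfl⟩ := List.map_eq_cons_iff.1 h
    have hs := List.pairwise_lt_finRange k
    rw [hl, List.pairwise_append] at hs
    have hj : ∀ j : Fin k, j < i → j ∈ l₁ := by
      intro j hj
      have hm := List.mem_finRange j
      rw [hl, List.mem_append, List.mem_cons] at hm
      rcases hm with hm | rfl | hm
      · exact hm
      · exact absurd hj (lt_irrefl _)
      · exact absurd ((List.pairwise_cons.1 hs.2.1).1 j hm) (not_lt_of_gt hj)
    refine ⟨by simp only [pos₂, pos]; omega, ?_⟩
    rintro ((j | j) | (j | j)) hv hv' <;> simp only [pos₂, pos] at hv hv'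
    · omega
    · refine Or.inr ⟨_, List.mem_map.2 ⟨j, hj j ?_, rfl⟩, Or.inl rfl⟩
      rw [Fin.lt_def]; omega
    · refine Or.inr ⟨_, List.mem_map.2 ⟨j, hj j ?_, rfl⟩, Or.inr rfl⟩
      rw [Fin.lt_def]; omega
    · omega
  have hp : ∀ u v : Fin k ⊕ Fin k, pos u < pos v → pos₂ (outer u) < pos₂ (outer v) := by
    rintro (u | u) (v | v) h <;> simp only [pos, pos₂, outer, Sum.map_inl, Sum.map_inr] at h ⊢ <;>
      omega
  rintro u v ⟨a, b, c⟩
  refine H (outer u) (outer v) ⟨hp _ _ a, ?_, ?_⟩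
  · rw [stack_outer]; exact hp _ _ b
  · rw [stack_outer d₁ d₂ u, stack_outer d₁ d₂ v]; exact hp _ _ c

end rows

end Matching

/-- A Motzkin `k`-diagram: a partial matching on the `2k` vertices `Sum.inl i` (top row) and
`Sum.inr i` (bottom row), `i : Fin k`, whose edges can be drawn inside the rectangle formed by the
vertices without crossings, that is, no two edges have interleaving ends along the boundary of the
rectangle. -/
structure MotzkinDiagram (k : ℕ) extends Matching (Fin k ⊕ Fin k) where
  planar : Matching.IsPlanar Matching.pos partner

namespace MotzkinDiagram

variable {k : ℕ}

theorem ext_toMatching {d₁ d₂ : MotzkinDiagram k} (h : d₁.toMatching = d₂.toMatching) :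
    d₁ = d₂ := by
  cases d₁; cases d₂; congr

/-- The diagram obtained by placing `d₁` above `d₂`, identifying the bottom row of `d₁` with the
top row of `d₂`, and deleting the middle row and the closed loops in it. -/
def comp (d₁ d₂ : MotzkinDiagram k) : MotzkinDiagram k :=
  ⟨Matching.comp d₁.toMatching d₂.toMatching,
    Matching.comp_planar d₁.toMatching d₂.toMatching d₁.planar d₂.planar⟩

/-- The number of closed loops that arise in the middle row when `d₁` is placed above `d₂`. -/
def loopNumber (d₁ d₂ : MotzkinDiagram k) : ℕ :=
  Matching.loopNumber d₁.toMatching d₂.toMatching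

/-- The diagram all of whose edges are the `k` edges joining a top vertex to the bottom vertex
below it. -/
def one (k : ℕ) : MotzkinDiagram k := ⟨Matching.one k, Matching.one_planar⟩

theorem comp_assoc (d₁ d₂ d₃ : MotzkinDiagram k) :
    comp (comp d₁ d₂) d₃ = comp d₁ (comp d₂ d₃) :=
  ext_toMatching (Matching.comp_assoc_aux _ _ _).1

theorem loopNumber_assoc (d₁ d₂ d₃ : MotzkinDiagram k) :
    loopNumber d₁ d₂ + loopNumber (comp d₁ d₂) d₃ =
      loopNumber d₂ d₃ + loopNumber d₁ (comp d₂ d₃) :=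
  (Matching.comp_assoc_aux _ _ _).2

theorem comp_one (d : MotzkinDiagram k) : comp d (one k) = d :=
  ext_toMatching (Matching.comp_one_aux _).1

theorem one_comp (d : MotzkinDiagram k) : comp (one k) d = d :=
  ext_toMatching (Matching.one_comp_aux _).1

theorem loopNumber_one (d : MotzkinDiagram k) : loopNumber d (one k) = 0 :=
  (Matching.comp_one_aux _).2

theorem one_loopNumber (d : MotzkinDiagram k) : loopNumber (one k) d = 0 :=
  (Matching.one_comp_aux _).2

end MotzkinDiagram

/-- The Motzkin algebra with parameter `x` over the commutative ring `K`: the free `K`-module with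
basis the Motzkin `k`-diagrams, with the multiplication given on diagrams by
`d₁ * d₂ = x ^ (number of loops) • (d₁ placed above d₂)`. -/
def MotzkinAlgebra (K : Type*) [CommRing K] (k : ℕ) (_x : K) : Type _ := MotzkinDiagram k →₀ K

namespace MotzkinAlgebra

variable {K : Type*} [CommRing K] {k : ℕ} {x : K}

noncomputable instance : AddCommGroup (MotzkinAlgebra K k x) :=
  inferInstanceAs (AddCommGroup (MotzkinDiagram k →₀ K))

noncomputable instance : Module K (MotzkinAlgebra K k x) :=
  inferInstanceAs (Module K (MotzkinDiagram k →₀ K))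

variable (x) in
/-- The basis vector given by a diagram. -/
noncomputable def ofDiagram (d : MotzkinDiagram k) : MotzkinAlgebra K k x :=
  Finsupp.single d (1 : K)

variable (K k x) in
/-- The basis of diagrams. -/
noncomputable def diagramBasis : Module.Basis (MotzkinDiagram k) K (MotzkinAlgebra K k x) :=
  Module.Basis.ofRepr (LinearEquiv.refl K (MotzkinDiagram k →₀ K))

theorem diagramBasis_apply (d : MotzkinDiagram k) : diagramBasis K k x d = ofDiagram x d := rfl

variable (K k x) in
/-- The multiplication of the Motzkin algebra, as the bilinear extension of the product of
diagrams. -/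
noncomputable def mulMap :
    MotzkinAlgebra K k x →ₗ[K] MotzkinAlgebra K k x →ₗ[K] MotzkinAlgebra K k x :=
  (diagramBasis K k x).constr K fun d₁ => (diagramBasis K k x).constr K fun d₂ =>
    x ^ MotzkinDiagram.loopNumber d₁ d₂ • ofDiagram x (MotzkinDiagram.comp d₁ d₂)

theorem mulMap_ofDiagram (d₁ d₂ : MotzkinDiagram k) :
    mulMap K k x (ofDiagram x d₁) (ofDiagram x d₂) =
      x ^ MotzkinDiagram.loopNumber d₁ d₂ • ofDiagram x (MotzkinDiagram.comp d₁ d₂) := by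
  simp only [mulMap, ← diagramBasis_apply, Module.Basis.constr_basis]

theorem span_ofDiagram : Submodule.span K (Set.range (ofDiagram (k := k) x)) = ⊤ :=
  (diagramBasis K k x).span_eq

theorem mulMap_assoc (a b c : MotzkinAlgebra K k x) :
    mulMap K k x (mulMap K k x a b) c = mulMap K k x a (mulMap K k x b c) := by
  have ind : ∀ p : MotzkinAlgebra K k x → Prop, (∀ d, p (ofDiagram x d)) → p 0 →
      (∀ u v, p u → p v → p (u + v)) → (∀ (r : K) u, p u → p (r • u)) → ∀ u, p u := by
    intro p h1 h2 h3 h4 u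
    have hu : u ∈ Submodule.span K (Set.range (ofDiagram (k := k) x)) := by
      rw [span_ofDiagram]; trivial
    induction hu using Submodule.span_induction with
    | mem u hu => obtain ⟨d, rfl⟩ := hu; exact h1 d
    | zero => exact h2
    | add u v _ _ hu hv => exact h3 u v hu hv
    | smul r u _ hu => exact h4 r u hu
  revert a b c
  refine ind _ (fun d₁ => ind _ (fun d₂ => ind _ (fun d₃ => ?_) ?_ ?_ ?_) ?_ ?_ ?_) ?_ ?_ ?_
  · simp only [mulMap_ofDiagram, map_smul, LinearMap.smul_apply, smul_smul, ← pow_add,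
      MotzkinDiagram.comp_assoc]
    rw [MotzkinDiagram.loopNumber_assoc]
  all_goals simp +contextual [LinearMap.add_apply, LinearMap.smul_apply]

theorem one_mulMap (a : MotzkinAlgebra K k x) :
    mulMap K k x (ofDiagram x (MotzkinDiagram.one k)) a = a := by
  have : mulMap K k x (ofDiagram x (MotzkinDiagram.one k)) = LinearMap.id := by
    refine (diagramBasis K k x).ext fun d => ?_
    rw [diagramBasis_apply, mulMap_ofDiagram, MotzkinDiagram.one_comp,
      MotzkinDiagram.one_loopNumber, pow_zero, one_smul, LinearMap.id_apply]
  rw [this, LinearMap.id_apply]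

theorem mulMap_one (a : MotzkinAlgebra K k x) :
    mulMap K k x a (ofDiagram x (MotzkinDiagram.one k)) = a := by
  have : (mulMap K k x).flip (ofDiagram x (MotzkinDiagram.one k)) = LinearMap.id := by
    refine (diagramBasis K k x).ext fun d => ?_
    rw [diagramBasis_apply, LinearMap.flip_apply, mulMap_ofDiagram, MotzkinDiagram.comp_one,
      MotzkinDiagram.loopNumber_one, pow_zero, one_smul, LinearMap.id_apply]
  rw [← LinearMap.flip_apply, this, LinearMap.id_apply]

noncomputable instance : Ring (MotzkinAlgebra K k x) :=
  { (inferInstance : AddCommGroup (MotzkinAlgebra K k x)) with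
    mul := fun a b => mulMap K k x a b
    one := ofDiagram x (MotzkinDiagram.one k)
    left_distrib := fun a b c => map_add (mulMap K k x a) b c
    right_distrib := fun a b c => LinearMap.map_add₂ (mulMap K k x) a b c
    zero_mul := fun a => LinearMap.map_zero₂ (mulMap K k x) a
    mul_zero := fun a => map_zero (mulMap K k x a)
    mul_assoc := mulMap_assoc
    one_mul := one_mulMap
    mul_one := mulMap_one }

theorem mul_def (a b : MotzkinAlgebra K k x) : a * b = mulMap K k x a b := rfl

noncomputable instance : Algebra K (MotzkinAlgebra K k x) :=
  Algebra.ofModule (fun r a b => LinearMap.map_smul₂ (mulMap K k x) r a b)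
    (fun r a b => map_smul (mulMap K k x a) r b)

end MotzkinAlgebra

/-! Let `Q n = corner k x n`, the idempotent that isolates all strands beyond the first `n` and
multiplies by `1 - dot k x i` for every `i < n`. It kills each diagram with an isolated vertex among
the first `n`, and inside its corner a closed loop counts `x - 1` instead of `x`: squaring `cupCap`
gives the factor `x`, and the inserted complement of a dot subtracts `cupCap * dot * cupCap =
cupCap`. Thus the compressed generators satisfy the Temperley–Lieb relations with parameter `x - 1`
(`isTemperleyLieb_corner`). Wenzl's recursion then gives idempotents `f n = jw u n n` killed by
these generators, as long as `u 1, …, u (n - 1)` do not vanish (`jonesWenzlProperties`).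

Elements killed by dots and by dotted cups see almost nothing of a diagram between them
(`mul_ofDiagram_mul`). An isolated vertex is absorbed by a dot; under a horizontal edge planarity
yields an edge joining neighbours, which is absorbed by a dotted cup; what remains is a row of
vertical edges, acting as the identity.

If no `u j` in the range vanishes, `f r * a * f s` is always a scalar multiple of `f r`. For `a` in
the Jacobson radical it is zero, since the radical contains no nonzero idempotent. Modulo diagrams
factoring through fewer strands, `f n` is the projection to `n` strands, so the `f n` generate the
algebra as a two-sided ideal (`one_mem_of_jw_mem`). Hence the radical is zero, and an Artinian ring
with zero radical is semisimple.

If `u (m + 1)` is the first zero, the Jones–Wenzl element `f` on `m + 1` strands still exists, but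
the next one does not. In the corner on `m + 2` strands, with last generator `e`, one has `e * f * e
= 0`. So `z = f * e * f` is killed by all generators and squares to zero, whence `z * a * z = 0` for
all `a`. A semisimple ring has no such `z ≠ 0`, yet one diagram has coefficient `1` in `z`
(`lastCoeff`). -/

namespace Matching

/-- `Walk f L v r`: follow the edges given by `f`, starting with the edge at `v` and passing from
one vertex of a pair in `L` to the other one; `r` is the outer end of this path, or `none` if the
path ends at an isolated vertex. -/
inductive Walk {V : Type*} (f : V → V) (L : List (V × V)) : V → Option V → Prop
  | isolated (v : V) (h : f v = v) : Walk f L v none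
  | arrive (v : V) (h : f v ≠ v) (h' : ∀ q ∈ L, q.1 ≠ f v ∧ q.2 ≠ f v) : Walk f L v (some (f v))
  | step (v c : V) (r : Option V) (h : f v ≠ v) (h' : (f v, c) ∈ L ∨ (c, f v) ∈ L)
      (w : Walk f L c r) : Walk f L v r

/-! ### Paths in glued matchings and the count of closed loops. -/

section walk

variable {V : Type*} [DecidableEq V]

/-- Gluing `p` merges the edge entering one vertex of `p` with the edge leaving the other, so a path
through `p` only loses this passage. The second half treats a vertex `u` whose edge leads into `p`,
while the rest of its path starts at the other vertex of `p`; the induction needs both halves at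
once. -/
theorem Walk.glue {f : Matching V} {p : V × V} {L : List (V × V)} {v : V} {r : Option V}
    (hp : ∀ q ∈ L, DisjPair p q) (hne : p.1 ≠ p.2) (w : Walk f.partner (p :: L) v r) :
    (v ≠ p.1 → v ≠ p.2 → Walk (f.glue p.1 p.2).partner L v r) ∧
    ∀ u, u ≠ p.1 → u ≠ p.2 →
      (v = p.2 ∧ f.partner u = p.1 ∨ v = p.1 ∧ f.partner u = p.2) →
      Walk (f.glue p.1 p.2).partner L u r := by
  have inv := f.invol
  obtain ⟨a, b⟩ := p
  simp only [DisjPair] at *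
  induction w with
  | isolated v h =>
    constructor
    · intro h1 h2
      exact .isolated _ (glue_fixed f _ _ _ h)
    · intro u hu1 hu2 h3
      refine .isolated _ ?_
      simp only [Matching.glue, glueFun]
      grind
  | arrive v h h' =>
    have h0 := h' (a, b) (by simp)
    have h1 : ∀ q ∈ L, q.1 ≠ f.partner v ∧ q.2 ≠ f.partner v := fun q hq => h' q (by simp [hq])
    constructor
    · intro h2 h3
      have e : (f.glue a b).partner v = f.partner v := by
        simp only [Matching.glue, glueFun]
        grind
      rw [← e]
      exact .arrive _ (by rw [e]; exact h) (by rw [e]; exact h1)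
    · intro u hu1 hu2 h3
      have e : (f.glue a b).partner u = f.partner v := by
        simp only [Matching.glue, glueFun]
        grind
      rw [← e]
      exact .arrive _ (by rw [e]; grind) (by rw [e]; exact h1)
  | step v c r h h' w ih =>
    constructor
    · intro h2 h3
      by_cases hc : f.partner v = a ∧ c = b ∨ f.partner v = b ∧ c = a
      · exact ih.2 v h2 h3 (by grind)
      · have h4 : (f.partner v, c) ∈ L ∨ (c, f.partner v) ∈ L := by grind
        have h5 : f.partner v ≠ a ∧ f.partner v ≠ b ∧ c ≠ a ∧ c ≠ b := by
          rcases h4 with h4 | h4 <;> have := hp _ h4 <;> grind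
        have e : (f.glue a b).partner v = f.partner v := by
          simp only [Matching.glue, glueFun]
          grind
        refine .step _ c _ (by rwa [e]) (by rwa [e]) (ih.1 h5.2.2.1 h5.2.2.2)
    · intro u hu1 hu2 h3
      have h4 : (f.partner v, c) ∈ L ∨ (c, f.partner v) ∈ L := by grind
      have h5 : f.partner v ≠ a ∧ f.partner v ≠ b ∧ c ≠ a ∧ c ≠ b := by
        rcases h4 with h4 | h4 <;> have := hp _ h4 <;> grind
      have e : (f.glue a b).partner u = f.partner v := by
        simp only [Matching.glue, glueFun]
        grind
      refine .step _ c _ (by rw [e]; grind) (by rwa [e]) (ih.1 h5.2.2.1 h5.2.2.2)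

/-- This replaces the evaluation of successive gluings by the exhibition of one path. -/
theorem glueList_partner_of_walk {L : List (V × V)} (f : Matching V) {v : V} {r : Option V}
    (hL : L.Pairwise DisjPair) (hne : ∀ p ∈ L, p.1 ≠ p.2)
    (hv : ∀ q ∈ L, v ≠ q.1 ∧ v ≠ q.2) (w : Walk f.partner L v r) :
    (glueList L f).partner v = r.getD v := by
  induction L generalizing f with
  | nil =>
    rcases w with ⟨_, h⟩ | _ | ⟨_, c, _, h, h'⟩
    · exact h
    · rfl
    · simp at h'
  | cons p L ih =>
    rw [List.pairwise_cons] at hL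
    have := hv p (by simp)
    exact ih _ hL.2 (fun q hq => hne q (by simp [hq])) (fun q hq => hv q (by simp [hq]))
      ((w.glue hL.1 (hne p (by simp))).1 this.1 this.2)

/-- Walks are finite, being given by an inductive predicate. If one edge joined both vertices of
`p`, the path from `p.1` would return to `p.1` forever. -/
theorem Walk.not_loop {f : V → V} {p : V × V} {L : List (V × V)} {v : V} {r : Option V}
    (hp : ∀ q ∈ L, DisjPair p q) (hne : p.1 ≠ p.2) (w : Walk f (p :: L) v r) (hv : v = p.1) :
    f p.1 ≠ p.2 := by
  obtain ⟨a, b⟩ := p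
  simp only [DisjPair] at *
  induction w with
  | isolated v h => grind
  | arrive v h h' => have := h' (a, b) (by simp); grind
  | step v c r h h' w ih =>
    intro h1
    by_cases hc : c = a
    · exact ih hc h1
    · have h4 : (f v, c) ∈ L ∨ (c, f v) ∈ L := by grind
      rcases h4 with h4 | h4 <;> have := hp _ h4 <;> grind

theorem loops_eq_zero {L : List (V × V)} (f : Matching V)
    (hL : L.Pairwise DisjPair) (hne : ∀ p ∈ L, p.1 ≠ p.2)
    (w : ∀ p ∈ L, ∃ r, Walk f.partner L p.1 r) : loops L f = 0 := by
  induction L generalizing f with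
  | nil => rfl
  | cons p L ih =>
    rw [List.pairwise_cons] at hL
    obtain ⟨r, hr⟩ := w p (by simp)
    have h1 := hr.not_loop hL.1 (hne p (by simp)) rfl
    simp only [loops, loop, h1, if_false, zero_add]
    refine ih _ hL.2 (fun q hq => hne q (by simp [hq])) fun q hq => ?_
    obtain ⟨r, hr⟩ := w q (by simp [hq])
    have := hL.1 q hq
    simp only [DisjPair] at this
    exact ⟨r, (hr.glue hL.1 (hne p (by simp))).1 (by grind) (by grind)⟩

theorem DisjPair.symm {V : Type*} {p q : V × V} (h : DisjPair p q) : DisjPair q p := by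
  simp only [DisjPair] at *
  grind

/-- Disjoint gluings commute, so the list can be rotated until `p` stands in front. -/
theorem exists_loops_eq_cons {L : List (V × V)} (hL : L.Pairwise DisjPair) {p : V × V}
    (hp : p ∈ L) : ∃ L', (p :: L').Pairwise DisjPair ∧ (∀ f, loops L f = loops (p :: L') f) ∧
      ∀ q, q ∈ L ↔ q ∈ p :: L' := by
  obtain ⟨l₁, l₂, rfl⟩ := List.append_of_mem hp
  have hP : (p :: (l₂ ++ l₁)).Pairwise DisjPair :=
    (List.perm_append_comm.pairwise_iff (l₂ := (p :: l₂) ++ l₁) fun h => h.symm).1 hL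
  refine ⟨l₂ ++ l₁, hP, fun f => ?_, fun q => ?_⟩
  · have := (glueList_swap l₁ (p :: l₂) f (fun a ha b hb =>
      (List.pairwise_append.1 hL).2.2 a ha b hb)).2
    simpa using this
  · simp only [List.mem_append, List.mem_cons]
    tauto

/-- Two edges that join the pairs `p` and `q` form one closed loop. -/
theorem loops_eq_one {L : List (V × V)} (f : Matching V) (hL : L.Pairwise DisjPair)
    (hne : ∀ p ∈ L, p.1 ≠ p.2) {p q : V × V} (hp : p ∈ L) (hq : q ∈ L) (hpq : p ≠ q)
    (h1 : f.partner p.1 = q.1) (h2 : f.partner p.2 = q.2)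
    (w : ∀ s ∈ L, s ≠ p → s ≠ q → ∃ r, Walk f.partner L s.1 r) : loops L f = 1 := by
  have inv := f.invol
  obtain ⟨M, hM, hM', hM''⟩ := exists_loops_eq_cons hL hp
  have hqM : q ∈ M := by
    have := (hM'' q).1 hq
    grind
  rw [List.pairwise_cons] at hM
  obtain ⟨N, hN, hN', hN''⟩ := exists_loops_eq_cons hM.2 hqM
  rw [List.pairwise_cons] at hN
  have hd := hM.1 q hqM
  rw [hM']
  simp only [loops, hN']
  have hz : loops N ((f.glue p.1 p.2).glue q.1 q.2) = 0 := by
    refine loops_eq_zero _ hN.2 (fun s hs => hne s ?_) fun s hs => ?_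
    · rw [hM'', List.mem_cons, hN'']; simp [hs]
    · have hsM : s ∈ M := by rw [hN'']; simp [hs]
      have hsL : s ∈ L := by rw [hM'']; simp [hsM]
      have d1 := hM.1 s hsM
      have d2 := hN.1 s hs
      simp only [DisjPair] at d1 d2
      obtain ⟨r, hr⟩ := w s hsL (by grind) (by grind)
      have mono : ∀ {L₁ L₂ : List (V × V)} {g : V → V} {v r}, (∀ q, q ∈ L₁ ↔ q ∈ L₂) →
          Walk g L₁ v r → Walk g L₂ v r := by
        intro L₁ L₂ g v r h w
        induction w with
        | isolated v h => exact .isolated v h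
        | arrive v h' h'' => exact .arrive v h' (by simpa only [h] using h'')
        | step v c r h' h'' w ih => exact .step v c r h' (by simpa only [h] using h'') ih
      have w1 := ((mono hM'' hr).glue hM.1 (hne p hp)).1 (by grind) (by grind)
      have w2 := ((mono hN'' w1).glue hN.1 (hne q hq)).1 (by grind) (by grind)
      exact ⟨r, w2⟩
  rw [hz]
  simp only [DisjPair] at hd
  simp only [loop, glue, glueFun]
  grind

end walk

end Matching
namespace Matching

/-! ### Products of concrete diagrams. -/

section diagrams

variable {k : ℕ}

theorem midPairs_pairwise : (midPairs k).Pairwise DisjPair := by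
  rw [midPairs, List.pairwise_map]
  refine (List.nodup_finRange k).imp fun h => ?_
  simp [DisjPair, h]

theorem ne_of_mem_midPairs {p} (hp : p ∈ midPairs k) : p.1 ≠ p.2 := by
  obtain ⟨i, -, rfl⟩ := List.mem_map.1 hp
  simp

theorem mem_midPairs (i : Fin k) : (Sum.inl (Sum.inr i), Sum.inr (Sum.inl i)) ∈ midPairs k :=
  List.mem_map.2 ⟨i, List.mem_finRange i, rfl⟩

/-- The path in the stacked picture of `d₁` above `d₂` that starts at `v`. -/
abbrev StackWalk (d₁ d₂ : Matching (Fin k ⊕ Fin k)) (v : (Fin k ⊕ Fin k) ⊕ (Fin k ⊕ Fin k))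
    (r : Option (Fin k ⊕ Fin k)) : Prop :=
  Walk (d₁.sum d₂).partner (midPairs k) v (r.map outer)

variable {d₁ d₂ : Matching (Fin k ⊕ Fin k)}

theorem comp_partner_of_walk {v : Fin k ⊕ Fin k} {r : Option (Fin k ⊕ Fin k)}
    (w : StackWalk d₁ d₂ (outer v) r) : (comp d₁ d₂).partner v = r.getD v := by
  have h := glueList_partner_of_walk (d₁.sum d₂) midPairs_pairwise
    (fun p hp => ne_of_mem_midPairs hp) (v := outer v) (r := r.map outer) (by
      intro q hq
      obtain ⟨i, -, rfl⟩ := List.mem_map.1 hq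
      rcases v with v | v <;> simp [outer]) w
  rw [stack_partner_outer] at h
  apply outer_injective
  rw [h]
  cases r <;> rfl

theorem loopNumber_eq_zero
    (h : ∀ i, ∃ r, StackWalk d₁ d₂ (Sum.inl (Sum.inr i)) r) : loopNumber d₁ d₂ = 0 := by
  refine loops_eq_zero _ midPairs_pairwise (fun p hp => ne_of_mem_midPairs hp) fun p hp => ?_
  obtain ⟨i, -, rfl⟩ := List.mem_map.1 hp
  obtain ⟨r, hr⟩ := h i
  exact ⟨_, hr⟩

theorem StackWalk.upper_isolated {v : Fin k ⊕ Fin k} (h : d₁.partner v = v) :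
    StackWalk d₁ d₂ (Sum.inl v) none :=
  .isolated _ (congrArg Sum.inl h)

theorem StackWalk.lower_isolated {v : Fin k ⊕ Fin k} (h : d₂.partner v = v) :
    StackWalk d₁ d₂ (Sum.inr v) none :=
  .isolated _ (congrArg Sum.inr h)

theorem StackWalk.upper_arrive {v : Fin k ⊕ Fin k} {i : Fin k} (h : d₁.partner v = Sum.inl i)
    (hv : Sum.inl i ≠ v) : StackWalk d₁ d₂ (Sum.inl v) (some (Sum.inl i)) := by
  have e : (d₁.sum d₂).partner (Sum.inl v) = Sum.inl (Sum.inl i) := congrArg Sum.inl h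
  have := Walk.arrive (f := (d₁.sum d₂).partner) (L := midPairs k) (Sum.inl v)
    (by rw [e]; simpa using hv) (by rw [e]; simp [midPairs])
  rwa [e] at this

theorem StackWalk.lower_arrive {v : Fin k ⊕ Fin k} {i : Fin k} (h : d₂.partner v = Sum.inr i)
    (hv : Sum.inr i ≠ v) : StackWalk d₁ d₂ (Sum.inr v) (some (Sum.inr i)) := by
  have e : (d₁.sum d₂).partner (Sum.inr v) = Sum.inr (Sum.inr i) := congrArg Sum.inr h
  have := Walk.arrive (f := (d₁.sum d₂).partner) (L := midPairs k) (Sum.inr v)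
    (by rw [e]; simpa using hv) (by rw [e]; simp [midPairs])
  rwa [e] at this

theorem StackWalk.upper_step {v : Fin k ⊕ Fin k} {i : Fin k} {r : Option (Fin k ⊕ Fin k)}
    (h : d₁.partner v = Sum.inr i) (hv : Sum.inr i ≠ v)
    (w : StackWalk d₁ d₂ (Sum.inr (Sum.inl i)) r) : StackWalk d₁ d₂ (Sum.inl v) r := by
  have e : (d₁.sum d₂).partner (Sum.inl v) = Sum.inl (Sum.inr i) := congrArg Sum.inl h
  refine Walk.step _ _ _ (by rw [e]; simpa using hv) ?_ w
  rw [e]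
  exact Or.inl (mem_midPairs i)

theorem StackWalk.lower_step {v : Fin k ⊕ Fin k} {i : Fin k} {r : Option (Fin k ⊕ Fin k)}
    (h : d₂.partner v = Sum.inl i) (hv : Sum.inl i ≠ v)
    (w : StackWalk d₁ d₂ (Sum.inl (Sum.inr i)) r) : StackWalk d₁ d₂ (Sum.inr v) r := by
  have e : (d₁.sum d₂).partner (Sum.inr v) = Sum.inr (Sum.inl i) := congrArg Sum.inr h
  refine Walk.step _ _ _ (by rw [e]; simpa using hv) ?_ w
  rw [e]
  exact Or.inr (mem_midPairs i)

theorem comp_partner_top {i j : Fin k} (h : d₁.partner (Sum.inl i) = Sum.inl j) :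
    (comp d₁ d₂).partner (Sum.inl i) = Sum.inl j := by
  by_cases hij : i = j
  · subst hij
    exact comp_partner_of_walk (r := none) (.upper_isolated h)
  · exact comp_partner_of_walk (r := some (Sum.inl j))
      (.upper_arrive h (by simpa using Ne.symm hij))

/-- A closed loop in the middle row needs a horizontal edge in the bottom row of the upper diagram,
and there is none. -/
theorem loopNumber_eq_zero_of_upper
    (h : ∀ i j, d₁.partner (Sum.inr i) = Sum.inr j → i = j) : loopNumber d₁ d₂ = 0 := by
  refine loopNumber_eq_zero fun i => ?_
  rcases hi : d₁.partner (Sum.inr i) with j | j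
  · exact ⟨_, .upper_arrive hi (by simp)⟩
  · obtain rfl := h i j hi
    exact ⟨_, .upper_isolated hi⟩

/-- The diagram joining the `i`-th top vertex to the `i`-th bottom vertex for `i ∈ S`, all other
vertices being isolated. -/
def proj (S : Finset (Fin k)) : Matching (Fin k ⊕ Fin k) where
  partner
    | Sum.inl i => if i ∈ S then Sum.inr i else Sum.inl i
    | Sum.inr i => if i ∈ S then Sum.inl i else Sum.inr i
  invol := by
    rintro (i | i) <;> by_cases h : i ∈ S <;> simp [h]

theorem proj_inl (S : Finset (Fin k)) (i : Fin k) :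
    (proj S).partner (Sum.inl i) = if i ∈ S then Sum.inr i else Sum.inl i := rfl

theorem proj_inr (S : Finset (Fin k)) (i : Fin k) :
    (proj S).partner (Sum.inr i) = if i ∈ S then Sum.inl i else Sum.inr i := rfl

theorem loopNumber_proj (S : Finset (Fin k)) (d : Matching (Fin k ⊕ Fin k)) :
    loopNumber (proj S) d = 0 := by
  refine loopNumber_eq_zero_of_upper fun i j h => ?_
  rw [proj_inr] at h
  split_ifs at h
  simpa using h

/-- Left multiplication with `proj S` isolates the top vertices outside `S` and their partners. -/
theorem comp_proj_partner (S : Finset (Fin k)) (d : Matching (Fin k ⊕ Fin k)) (v : Fin k ⊕ Fin k) :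
    (comp (proj S) d).partner v =
      if ∃ i ∉ S, v = Sum.inl i ∨ d.partner v = Sum.inl i then v else d.partner v := by
  have key : ∀ w, (∀ i ∉ S, d.partner w ≠ Sum.inl i) → d.partner w ≠ w →
      StackWalk (proj S) d (Sum.inr w) (some (d.partner w)) := by
    intro w h1 h2
    rcases hw : d.partner w with j | j
    · by_cases hj : j ∈ S
      · exact .lower_step hw (hw ▸ h2) (.upper_arrive (by simp [proj_inr, hj]) (by simp))
      · exact absurd hw (h1 j hj)
    · exact .lower_arrive hw (hw ▸ h2)
  have key2 : ∀ w i, i ∉ S → d.partner w = Sum.inl i → StackWalk (proj S) d (Sum.inr w) none := by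
    intro w i hi hw
    by_cases h2 : d.partner w = w
    · exact .lower_isolated h2
    · exact .lower_step hw (hw ▸ h2) (.upper_isolated (by simp [proj_inr, hi]))
  have key3 : ∀ i, i ∈ S → ∀ r, StackWalk (proj S) d (Sum.inr (Sum.inl i)) r →
      StackWalk (proj S) d (outer (Sum.inl i)) r := by
    intro i hi r w
    exact .upper_step (by simp [proj_inl, hi]) (by simp) w
  have key4 : ∀ w, (∀ i ∉ S, w ≠ Sum.inl i) → ∀ r, StackWalk (proj S) d (Sum.inr w) r →
      StackWalk (proj S) d (outer w) r := by
    rintro (i | i) h r w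
    · exact key3 i (by by_contra hi; exact h i hi rfl) r w
    · exact w
  split_ifs with h
  · obtain ⟨i, hi, rfl | h⟩ := h
    · exact comp_partner_top (by simp [proj_inl, hi])
    · by_cases h' : ∃ j ∉ S, v = Sum.inl j
      · obtain ⟨j, hj, rfl⟩ := h'
        exact comp_partner_top (by simp [proj_inl, hj])
      · push Not at h'
        exact comp_partner_of_walk (r := none) (key4 v h' _ (key2 v i hi h))
  · push Not at h
    have w := key4 v (fun i hi => (h i hi).1)
    by_cases h2 : d.partner v = v
    · rw [h2]
      exact comp_partner_of_walk (r := none) (w _ (.lower_isolated h2))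
    · exact comp_partner_of_walk (r := some _) (w _ (key v (fun i hi => (h i hi).2) h2))

/-- The diagram with a horizontal edge joining `i` and `j` in the top row and in the bottom row,
and all vertical edges at the other places. -/
def cupCap (i j : Fin k) (_hij : i ≠ j) : Matching (Fin k ⊕ Fin k) where
  partner
    | Sum.inl a => if a = i then Sum.inl j else if a = j then Sum.inl i else Sum.inr a
    | Sum.inr a => if a = i then Sum.inr j else if a = j then Sum.inr i else Sum.inl a
  invol := by
    rintro (a | a) <;> by_cases h : a = i <;> by_cases h' : a = j <;> simp_all

theorem cupCap_inl (i j : Fin k) (hij : i ≠ j) (a : Fin k) :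
    (cupCap i j hij).partner (Sum.inl a) =
      if a = i then Sum.inl j else if a = j then Sum.inl i else Sum.inr a := rfl

theorem cupCap_inr (i j : Fin k) (hij : i ≠ j) (a : Fin k) :
    (cupCap i j hij).partner (Sum.inr a) =
      if a = i then Sum.inr j else if a = j then Sum.inr i else Sum.inl a := rfl

theorem cupCap_symm (i j : Fin k) (hij : i ≠ j) : cupCap i j hij = cupCap j i hij.symm := by
  apply ext_partner
  rintro (a | a) <;> simp only [cupCap_inl, cupCap_inr] <;> grind

/-- A path that reaches the lower horizontal edge of the upper diagram at one end continues from the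
other end. For all other vertices of `d`, the effect is therefore the gluing of the top vertices `i`
and `j` of `d`. -/
theorem cupCap_walk {i j : Fin k} (hij : i ≠ j) {d : Matching (Fin k ⊕ Fin k)}
    {w : Fin k ⊕ Fin k} (hi : w ≠ Sum.inl i) (hj : w ≠ Sum.inl j) :
    StackWalk (cupCap i j hij) d (Sum.inr w)
      (if (d.glue (Sum.inl i) (Sum.inl j)).partner w = w then none
        else some ((d.glue (Sum.inl i) (Sum.inl j)).partner w)) := by
  have inv := d.invol
  have key : ∀ i j (hij : i ≠ j) w, w ≠ Sum.inl i → w ≠ Sum.inl j →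
      d.partner w = Sum.inl i → StackWalk (cupCap i j hij) d (Sum.inr w)
        (if d.partner (Sum.inl j) = Sum.inl j then none else some (d.partner (Sum.inl j))) := by
    intro i j hij w hi hj h
    refine .lower_step h hi.symm (.upper_step (i := j) (by simp [cupCap_inr])
      (by simpa using hij.symm) ?_)
    split_ifs with h1
    · exact .lower_isolated h1
    · rcases h2 : d.partner (Sum.inl j) with l | l
      · refine .lower_step h2 (h2 ▸ h1) (.upper_arrive ?_ (by simp))
        have : l ≠ j := by rintro rfl; exact h1 h2
        have : l ≠ i := by rintro rfl; grind
        simp [cupCap_inr, *]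
      · exact .lower_arrive h2 (by simp)
  by_cases h0 : d.partner w = w
  · rw [if_pos (glue_fixed d _ _ w h0)]
    exact .lower_isolated h0
  · by_cases h1 : d.partner w = Sum.inl i
    · convert key i j hij w hi hj h1 using 1
      simp only [glue, glueFun]
      grind
    · by_cases h2 : d.partner w = Sum.inl j
      · rw [cupCap_symm]
        convert key j i hij.symm w hj hi h2 using 1
        simp only [glue, glueFun]
        grind
      · have e : (d.glue (Sum.inl i) (Sum.inl j)).partner w = d.partner w := by
          simp only [glue, glueFun]
          grind
        rw [e, if_neg h0]
        rcases h3 : d.partner w with l | l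
        · refine .lower_step h3 (h3 ▸ h0) (.upper_arrive ?_ (by simp))
          simp only [cupCap_inr]
          grind
        · exact .lower_arrive h3 (h3 ▸ h0)

theorem comp_cupCap_partner {i j : Fin k} (hij : i ≠ j) (d : Matching (Fin k ⊕ Fin k))
    (v : Fin k ⊕ Fin k) :
    (comp (cupCap i j hij) d).partner v =
      if v = Sum.inl i then Sum.inl j else if v = Sum.inl j then Sum.inl i
      else (d.glue (Sum.inl i) (Sum.inl j)).partner v := by
  split_ifs with h h'
  · subst h
    exact comp_partner_top (by simp [cupCap_inl])
  · subst h'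
    exact comp_partner_top (by simp [cupCap_inl, hij.symm])
  · have w := cupCap_walk hij (d := d) h h'
    have w' : StackWalk (cupCap i j hij) d (outer v)
        (if (d.glue (Sum.inl i) (Sum.inl j)).partner v = v then none
        else some ((d.glue (Sum.inl i) (Sum.inl j)).partner v)) := by
      rcases v with a | a
      · refine .upper_step ?_ (by simp) w
        simp only [cupCap_inl]
        grind
      · exact w
    have := comp_partner_of_walk w'
    split_ifs at this with h1
    · rw [this, h1]; rfl
    · exact this

/-- The edge between `i` and `j` is the only horizontal one in the bottom row of the upper diagram,
so only the same edge in the top row of `d` could close it to a loop. -/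
theorem loopNumber_cupCap {i j : Fin k} (hij : i ≠ j) {d : Matching (Fin k ⊕ Fin k)}
    (h : d.partner (Sum.inl i) ≠ Sum.inl j) : loopNumber (cupCap i j hij) d = 0 := by
  have inv := d.invol
  have key : ∀ i j (hij : i ≠ j), d.partner (Sum.inl i) ≠ Sum.inl j →
      ∃ r, StackWalk (cupCap i j hij) d (Sum.inl (Sum.inr i)) r := by
    intro i j hij h
    have e : (cupCap i j hij).partner (Sum.inr i) = Sum.inr j := by simp [cupCap_inr]
    by_cases h1 : d.partner (Sum.inl j) = Sum.inl j
    · exact ⟨_, .upper_step e (by simpa using hij.symm) (.lower_isolated h1)⟩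
    · rcases h2 : d.partner (Sum.inl j) with l | l
      · refine ⟨_, .upper_step e (by simpa using hij.symm)
          (.lower_step h2 (h2 ▸ h1) (.upper_arrive (i := l) ?_ (by simp)))⟩
        simp only [cupCap_inr]
        grind
      · exact ⟨_, .upper_step e (by simpa using hij.symm) (.lower_arrive h2 (by simp))⟩
  refine loopNumber_eq_zero fun a => ?_
  by_cases h1 : a = i
  · subst h1; exact key a j hij h
  · by_cases h2 : a = j
    · subst h2
      rw [cupCap_symm]
      exact key a i hij.symm (by grind)
    · exact ⟨_, .upper_arrive (i := a) (by simp [cupCap_inr, h1, h2]) (by simp)⟩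

theorem loopNumber_cupCap_self {i j : Fin k} (hij : i ≠ j) :
    loopNumber (cupCap i j hij) (cupCap i j hij) = 1 := by
  refine loops_eq_one _ midPairs_pairwise (fun p hp => ne_of_mem_midPairs hp)
    (mem_midPairs i) (mem_midPairs j) (by simpa using hij) ?_ ?_ ?_
  · simp [Matching.sum, cupCap_inr]
  · simp [Matching.sum, cupCap_inl]
  · intro s hs hsi hsj
    obtain ⟨a, -, rfl⟩ := List.mem_map.1 hs
    exact ⟨_, StackWalk.upper_arrive (i := a)
      (by simp only [cupCap_inr]; grind) (by simp)⟩

theorem comp_cupCap_self {i j : Fin k} (hij : i ≠ j) :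
    comp (cupCap i j hij) (cupCap i j hij) = cupCap i j hij := by
  apply ext_partner
  intro v
  have inv := (cupCap i j hij).invol
  rw [comp_cupCap_partner]
  rcases v with a | a <;> simp only [glue, glueFun, cupCap_inl, cupCap_inr] <;> grind

/-- Cutting the strand at `i` removes the edge of `d` and isolates both its ends; the horizontal
edge of `cupCap` then restores it. No loop arises on the way, so the factorization remains valid for
`x = 0`. -/
theorem comp_cupCap_proj_of_edge {i j : Fin k} (hij : i ≠ j) {d : Matching (Fin k ⊕ Fin k)}
    (h : d.partner (Sum.inl i) = Sum.inl j) :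
    comp (cupCap i j hij) (comp (proj {i}ᶜ) d) = d := by
  apply ext_partner
  intro v
  have inv := d.invol
  have e : ∀ v, (comp (proj {i}ᶜ) d).partner v =
      if v = Sum.inl i ∨ d.partner v = Sum.inl i then v else d.partner v := by
    intro v
    rw [comp_proj_partner]
    simp
  rw [comp_cupCap_partner]
  simp only [glue, glueFun, e]
  grind

theorem comp_proj_partner_inl (S : Finset (Fin k)) (d : Matching (Fin k ⊕ Fin k)) {i : Fin k}
    (hi : i ∉ S) : (comp (proj S) d).partner (Sum.inl i) = Sum.inl i :=
  comp_partner_top (by simp [proj_inl, hi])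

theorem comp_proj_eq_self {S : Finset (Fin k)} {d : Matching (Fin k ⊕ Fin k)}
    (h : ∀ i ∉ S, d.partner (Sum.inl i) = Sum.inl i) : comp (proj S) d = d := by
  apply ext_partner
  intro v
  have inv := d.invol
  rw [comp_proj_partner]
  split_ifs with h'
  · obtain ⟨i, hi, rfl | h'⟩ := h'
    · exact (h i hi).symm
    · have := h i hi
      grind
  · rfl

theorem comp_proj_proj (S T : Finset (Fin k)) : comp (proj S) (proj T) = proj (S ∩ T) := by
  apply ext_partner
  intro v
  rw [comp_proj_partner]
  rcases v with a | a <;> by_cases hS : a ∈ S <;> by_cases hT : a ∈ T <;>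
    simp [proj_inl, proj_inr, hS, hT]

/-- Cutting an edge at either end isolates both ends. -/
theorem comp_proj_cupCap {i j : Fin k} (hij : i ≠ j) :
    comp (proj {i}ᶜ) (cupCap i j hij) = comp (proj {j}ᶜ) (cupCap i j hij) := by
  apply ext_partner
  intro v
  simp only [comp_proj_partner, Finset.mem_compl, Finset.mem_singleton, not_not, exists_eq_left]
  rcases v with a | a <;> simp only [cupCap_inl, cupCap_inr] <;> grind

theorem comp_proj_cupCap_comm {i j : Fin k} (hij : i ≠ j) {S : Finset (Fin k)} (hi : i ∈ S)
    (hj : j ∈ S) : comp (proj S) (cupCap i j hij) = comp (cupCap i j hij) (proj S) := by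
  apply ext_partner
  intro v
  rw [comp_cupCap_partner, comp_proj_partner]
  rcases v with a | a <;> by_cases h1 : a = i <;> by_cases h2 : a = j <;> by_cases h3 : a ∈ S <;>
    simp_all [glue, glueFun, cupCap_inl, cupCap_inr, proj_inl, proj_inr] <;> grind

theorem comp_cupCap_braid {i j l : Fin k} (hij : i ≠ j) (hjl : j ≠ l) (hil : i ≠ l) :
    comp (cupCap i j hij) (comp (cupCap j l hjl) (cupCap i j hij)) = cupCap i j hij := by
  apply ext_partner
  intro v
  have e := comp_cupCap_partner hjl (cupCap i j hij)
  rw [comp_cupCap_partner]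
  simp only [glue, glueFun, e]
  rcases v with a | a <;> simp only [cupCap_inl, cupCap_inr] <;> grind

theorem comp_cupCap_comm {i j a b : Fin k} (hij : i ≠ j) (hab : a ≠ b) (h1 : i ≠ a) (h2 : i ≠ b)
    (h3 : j ≠ a) (h4 : j ≠ b) :
    comp (cupCap i j hij) (cupCap a b hab) = comp (cupCap a b hab) (cupCap i j hij) := by
  apply ext_partner
  intro v
  simp only [comp_cupCap_partner, glue, glueFun]
  rcases v with c | c <;> simp only [cupCap_inl, cupCap_inr] <;> grind

theorem isPlanar_proj (S : Finset (Fin k)) : IsPlanar pos (proj S).partner := by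
  rintro (a | a) (b | b) <;> simp only [proj_inl, proj_inr] <;> split_ifs <;>
    simp only [pos] <;> omega

theorem isPlanar_cupCap {i j : Fin k} (hij : i ≠ j) (h : (i : ℕ) + 1 = j) :
    IsPlanar pos (cupCap i j hij).partner := by
  rintro (a | a) (b | b) <;> simp only [cupCap_inl, cupCap_inr] <;> split_ifs <;>
    simp only [pos] <;> (simp_all only [Fin.ext_iff]; omega)

/-- The reflection of a diagram in the horizontal axis. -/
def flip (d : Matching (Fin k ⊕ Fin k)) : Matching (Fin k ⊕ Fin k) where
  partner v := (d.partner v.swap).swap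
  invol v := by simp [d.invol]

theorem flip_flip (d : Matching (Fin k ⊕ Fin k)) : flip (flip d) = d := by
  apply ext_partner
  intro v
  simp [flip]

/-- The map `e` turns the stacked picture upside down. It exchanges the vertices within each
identified pair, and gluing is symmetric in the two vertices. -/
theorem flip_comp_aux (d₁ d₂ : Matching (Fin k ⊕ Fin k)) :
    comp (flip d₂) (flip d₁) = flip (comp d₁ d₂) ∧
      loopNumber (flip d₂) (flip d₁) = loopNumber d₁ d₂ := by
  let P := Fin k ⊕ Fin k
  let e : P ⊕ P → P ⊕ P := fun v => (Sum.map Sum.swap Sum.swap v).swap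
  have he : Function.Injective e := by
    rintro ((i | i) | (i | i)) ((j | j) | (j | j)) h <;> simp_all [e]
  have hm : (midPairs k).map (Prod.map e e) = (midPairs k).map Prod.swap := by
    simp [midPairs, e, Function.comp_def]
  have A := glueList_map e he (midPairs k) (d₁.sum d₂) ((flip d₂).sum (flip d₁)) (by
    rintro (v | v) <;> simp [e, Matching.sum, flip])
  rw [hm, (glueList_symm _ _).1, (glueList_symm _ _).2] at A
  refine ⟨ext_partner fun v => outer_injective ?_, A.2⟩
  have ho : ∀ v : P, e (outer v.swap) = outer v := by rintro (v | v) <;> rfl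
  rw [← stack_partner_outer, ← ho v, A.1, stack_partner_outer,
    ← ho ((flip (comp d₁ d₂)).partner v)]
  simp only [flip, Sum.swap_swap]

theorem isPlanar_flip {d : Matching (Fin k ⊕ Fin k)} (h : IsPlanar pos d.partner) :
    IsPlanar pos (flip d).partner := by
  have hs : ∀ v : Fin k ⊕ Fin k, pos v.swap = 2 * k - 1 - pos v := by
    rintro (v | v)
    · rfl
    · simp only [Sum.swap_inr, pos]
      omega
  intro u v
  -- Reflection reverses the order along the boundary, so a crossing of the edges at `u` and `v`
  -- becomes a crossing read from their other ends in the opposite order.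
  have := h (d.partner v.swap) (d.partner u.swap)
  have l1 := pos_lt u
  have l2 := pos_lt v
  have l3 := pos_lt (d.partner v.swap)
  have l4 := pos_lt (d.partner u.swap)
  simp only [d.invol, hs] at this
  simp only [flip, hs]
  omega

theorem flip_proj (S : Finset (Fin k)) : flip (proj S) = proj S := by
  apply ext_partner
  rintro (a | a) <;> simp only [flip, Sum.swap_inl, Sum.swap_inr, proj_inl, proj_inr] <;>
    split_ifs <;> rfl

theorem flip_cupCap {i j : Fin k} (hij : i ≠ j) : flip (cupCap i j hij) = cupCap i j hij := by
  apply ext_partner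
  rintro (a | a) <;> simp only [flip, Sum.swap_inl, Sum.swap_inr, cupCap_inl, cupCap_inr] <;>
    split_ifs <;> rfl

open Classical in
/-- The diagram joining the `s a`-th top vertex to the `t a`-th bottom vertex for all `a`, all
other vertices being isolated. -/
noncomputable def rook {n : ℕ} (s t : Fin n ↪o Fin k) : Matching (Fin k ⊕ Fin k) where
  partner
    | Sum.inl i => if h : ∃ a, s a = i then Sum.inr (t h.choose) else Sum.inl i
    | Sum.inr i => if h : ∃ a, t a = i then Sum.inl (s h.choose) else Sum.inr i
  invol := by
    rintro (i | i)
    · by_cases h : ∃ a, s a = i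
      · obtain ⟨a, rfl⟩ := h
        simp
      · simp [h]
    · by_cases h : ∃ a, t a = i
      · obtain ⟨a, rfl⟩ := h
        simp
      · simp [h]

section rook

variable {n : ℕ} (s t : Fin n ↪o Fin k)

theorem rook_inl (a : Fin n) : (rook s t).partner (Sum.inl (s a)) = Sum.inr (t a) := by
  simp [rook]

theorem rook_inr (a : Fin n) : (rook s t).partner (Sum.inr (t a)) = Sum.inl (s a) := by
  simp [rook]

theorem rook_inl_of_notMem {i : Fin k} (h : ∀ a, s a ≠ i) :
    (rook s t).partner (Sum.inl i) = Sum.inl i := by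
  simp [rook, h]

theorem rook_inr_of_notMem {i : Fin k} (h : ∀ a, t a ≠ i) :
    (rook s t).partner (Sum.inr i) = Sum.inr i := by
  simp [rook, h]

theorem isPlanar_rook : IsPlanar pos (rook s t).partner := by
  rintro (i | i) v
  · by_cases hi : ∃ a, s a = i
    · obtain ⟨a, rfl⟩ := hi
      rw [rook_inl]
      rcases v with j | j
      · by_cases hj : ∃ a, s a = j
        · obtain ⟨b, rfl⟩ := hj
          rw [rook_inl]
          rintro ⟨h1, h2, h3⟩
          have h4 : a < b := s.lt_iff_lt.1 h1
          have h5 : t a < t b := t.lt_iff_lt.2 h4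
          simp only [pos] at h3
          omega
        · rw [rook_inl_of_notMem s t (by simpa using hj)]
          omega
      · by_cases hj : ∃ a, t a = j
        · obtain ⟨b, rfl⟩ := hj
          rw [rook_inr]
          simp only [pos]
          omega
        · rw [rook_inr_of_notMem s t (by simpa using hj)]
          omega
    · rw [rook_inl_of_notMem s t (by simpa using hi)]
      omega
  · by_cases hi : ∃ a, t a = i
    · obtain ⟨a, rfl⟩ := hi
      rw [rook_inr]
      simp only [pos]
      omega
    · rw [rook_inr_of_notMem s t (by simpa using hi)]
      omega

theorem loopNumber_rook (d : Matching (Fin k ⊕ Fin k)) : loopNumber (rook s t) d = 0 := by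
  refine loopNumber_eq_zero_of_upper fun i j h => ?_
  by_cases hi : ∃ a, t a = i
  · obtain ⟨a, rfl⟩ := hi
    simp [rook_inr] at h
  · rw [rook_inr_of_notMem s t (by simpa using hi)] at h
    simpa using h

theorem comp_rook (u : Fin n ↪o Fin k) : comp (rook s t) (rook t u) = rook s u := by
  apply ext_partner
  rintro (i | i)
  · by_cases hi : ∃ a, s a = i
    · obtain ⟨a, rfl⟩ := hi
      rw [rook_inl]
      exact comp_partner_of_walk (r := some _) (.upper_step (rook_inl s t a) (by simp)
        (.lower_arrive (rook_inl t u a) (by simp)))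
    · have hi' : ∀ a, s a ≠ i := by simpa using hi
      rw [rook_inl_of_notMem s u hi']
      exact comp_partner_of_walk (r := none) (.upper_isolated (rook_inl_of_notMem s t hi'))
  · by_cases hi : ∃ a, u a = i
    · obtain ⟨a, rfl⟩ := hi
      rw [rook_inr]
      exact comp_partner_of_walk (r := some _) (.lower_step (rook_inr t u a) (by simp)
        (.upper_arrive (rook_inr s t a) (by simp)))
    · have hi' : ∀ a, u a ≠ i := by simpa using hi
      rw [rook_inr_of_notMem s u hi']
      exact comp_partner_of_walk (r := none) (.lower_isolated (rook_inr_of_notMem t u hi'))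

theorem rook_self : rook s s = proj (Finset.univ.map s.toEmbedding) := by
  apply ext_partner
  rintro (i | i)
  · by_cases hi : ∃ a, s a = i
    · obtain ⟨a, rfl⟩ := hi
      simp [rook_inl, proj_inl]
    · rw [rook_inl_of_notMem s s (by simpa using hi), proj_inl, if_neg]
      simpa using hi
  · by_cases hi : ∃ a, s a = i
    · obtain ⟨a, rfl⟩ := hi
      simp [rook_inr, proj_inr]
    · rw [rook_inr_of_notMem s s (by simpa using hi), proj_inr, if_neg]
      simpa using hi

end rook

end diagrams

end Matching

/-! ### Temperley–Lieb relations and Wenzl's recursion. -/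

/-- Elements `e 0, …, e (N - 1)` of an algebra that satisfy the relations of the Temperley–Lieb
algebra with loop parameter `δ` and unit `P`. -/
structure IsTemperleyLieb {K A : Type*} [CommRing K] [Ring A] [Algebra K A] (P : A) (e : ℕ → A)
    (δ : K) (N : ℕ) : Prop where
  unit_mul_unit : P * P = P
  unit_mul : ∀ i < N, P * e i = e i
  mul_unit : ∀ i < N, e i * P = e i
  mul_self : ∀ i < N, e i * e i = δ • e i
  braid : ∀ i, i + 1 < N → e (i + 1) * e i * e (i + 1) = e (i + 1)
  comm : ∀ i j, i + 1 < j → j < N → e i * e j = e j * e i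

section JonesWenzl

variable {K A : Type*} [Field K] [Ring A] [Algebra K A]

/-- The Jones–Wenzl elements. -/
def jonesWenzl (u : ℕ → K) (P : A) (e : ℕ → A) : ℕ → A
  | 0 => P
  -- The index counts strands; below two strands there is no generator, so both initial values are
  -- the unit.
  | 1 => P
  | m + 2 => jonesWenzl u P e (m + 1) -
      (u m / u (m + 1)) • (jonesWenzl u P e (m + 1) * e m * jonesWenzl u P e (m + 1))

variable {u : ℕ → K} {P : A} {e : ℕ → A} {δ : K} {N : ℕ}

theorem jonesWenzl_add_two (m : ℕ) : jonesWenzl u P e (m + 2) = jonesWenzl u P e (m + 1) -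
      (u m / u (m + 1)) • (jonesWenzl u P e (m + 1) * e m * jonesWenzl u P e (m + 1)) := rfl

/-- The properties of the `m`-th and the `m + 1`-st Jones–Wenzl element that are proved
simultaneously. -/
structure JonesWenzlProperties (u : ℕ → K) (P : A) (e : ℕ → A) (N m : ℕ) (g f : A) : Prop where
  unit_mul : P * f = f
  mul_unit : f * P = f
  mul_self : f * f = f
  mul_prev : f * g = f
  prev_mul : g * f = f
  gen_mul : ∀ i < m, e i * f = 0
  mul_gen : ∀ i < m, f * e i = 0
  comm : ∀ i, m < i → i < N → e i * f = f * e i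
  comm_prev : ∀ i, m ≤ i → i < N → e i * g = g * e i
  gen_mul_gen : m < N → e m * f * e m = (u (m + 1) / u m) • (g * e m)

/-- Everything rests on `gen_mul_gen`: the scalar `u (m + 1) / u m` found there is the inverse of
the coefficient in the recursion, so the next element is idempotent and killed by the new generator.
Only `u 1, …, u m` must be nonzero; `u (m + 1)` may vanish, which is the case used against
semisimplicity. -/
theorem IsTemperleyLieb.jonesWenzlProperties (h : IsTemperleyLieb P e δ N) (hu0 : u 0 = 1)
    (hu1 : u 1 = δ) (hu : ∀ m, u (m + 2) = δ * u (m + 1) - u m) (m : ℕ) (hm : m ≤ N)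
    (hne : ∀ j, 1 ≤ j → j ≤ m → u j ≠ 0) :
    JonesWenzlProperties u P e N m (jonesWenzl u P e m) (jonesWenzl u P e (m + 1)) := by
  induction m with
  | zero =>
    have hP : ∀ i < N, e i * P = P * e i := fun i hi => by rw [h.mul_unit i hi, h.unit_mul i hi]
    refine ⟨h.unit_mul_unit, h.unit_mul_unit, h.unit_mul_unit, h.unit_mul_unit, h.unit_mul_unit,
      by simp, by simp, fun i _ hi => hP i hi, fun i _ hi => hP i hi, fun h0 => ?_⟩
    simp only [jonesWenzl]
    rw [h.mul_unit 0 h0, h.unit_mul 0 h0, h.mul_self 0 h0, hu0, zero_add, hu1, div_one]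
  | succ m ih =>
    have I := ih (by omega) (fun j h1 h2 => hne j h1 (by omega))
    have hm0 : u m ≠ 0 := by
      rcases Nat.eq_zero_or_pos m with rfl | h1
      · rw [hu0]; exact one_ne_zero
      · exact hne m h1 (by omega)
    have hm1 : u (m + 1) ≠ 0 := hne _ (by omega) le_rfl
    rw [jonesWenzl_add_two]
    generalize jonesWenzl u P e (m + 1) = f at *
    generalize jonesWenzl u P e m = g at *
    set c := u m / u (m + 1) with hc
    have hcd : c * (u (m + 1) / u m) = 1 := by rw [hc]; field_simp
    have hmN : m < N := by omega
    have E := I.gen_mul_gen hmN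
    have hge := I.comm_prev m le_rfl hmN
    -- Since `c` is the inverse of this scalar, the recursion subtracts the idempotent `c • (f * e m
    -- * f)` from `f`.
    have a1 : f * e m * f * (f * e m * f) = (u (m + 1) / u m) • (f * e m * f) := by
      calc f * e m * f * (f * e m * f) = f * (e m * (f * f) * e m) * f := by noncomm_ring
        _ = (u (m + 1) / u m) • (f * g * e m * f) := by
          rw [I.mul_self, E, mul_smul_comm, smul_mul_assoc, mul_assoc f g]
        _ = _ := by rw [I.mul_prev]
    have a2 : f * (f * e m * f) = f * e m * f := by
      rw [← mul_assoc, ← mul_assoc, I.mul_self]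
    have a3 : f * e m * f * f = f * e m * f := by rw [mul_assoc, I.mul_self]
    refine ⟨?_, ?_, ?_, ?_, ?_, ?_, ?_, ?_, ?_, ?_⟩
    · rw [mul_sub, mul_smul_comm, ← mul_assoc, ← mul_assoc, I.unit_mul]
    · rw [sub_mul, smul_mul_assoc, mul_assoc, I.mul_unit]
    · rw [sub_mul, mul_sub, mul_sub, mul_smul_comm, smul_mul_assoc, smul_mul_assoc, mul_smul_comm,
        a1, a2, a3, I.mul_self, smul_smul c (u (m + 1) / u m), hcd, one_smul]
      abel
    · rw [sub_mul, smul_mul_assoc, a3, I.mul_self]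
    · rw [mul_sub, mul_smul_comm, a2, I.mul_self]
    · intro i hi
      rcases Nat.lt_succ_iff_lt_or_eq.1 hi with hi | rfl
      · rw [mul_sub, mul_smul_comm, ← mul_assoc, ← mul_assoc, I.gen_mul i hi]
        simp
      · rw [mul_sub, mul_smul_comm, ← mul_assoc, ← mul_assoc, E, smul_mul_assoc, smul_smul, hcd,
          one_smul, ← hge, mul_assoc, I.prev_mul, sub_self]
    · intro i hi
      rcases Nat.lt_succ_iff_lt_or_eq.1 hi with hi | rfl
      · rw [sub_mul, smul_mul_assoc, mul_assoc, I.mul_gen i hi]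
        simp
      · rw [sub_mul, smul_mul_assoc, mul_assoc, mul_assoc, ← mul_assoc (e i), E, mul_smul_comm,
          smul_smul, hcd, one_smul, ← mul_assoc, I.mul_prev, sub_self]
    · intro i h1 h2
      have b1 := I.comm i (by omega) h2
      have b2 := h.comm m i (by omega) h2
      have b3 : e i * (f * e m * f) = f * e m * f * e i := by
        calc e i * (f * e m * f) = (e i * f) * e m * f := by noncomm_ring
          _ = f * (e i * e m) * f := by rw [b1]; noncomm_ring
          _ = f * e m * (e i * f) := by rw [← b2]; noncomm_ring
          _ = _ := by rw [b1]; noncomm_ring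
      rw [mul_sub, sub_mul, mul_smul_comm, smul_mul_assoc, b1, b3]
    · intro i h1 h2
      exact I.comm i (by omega) h2
    · intro h1
      have b1 := I.comm (m + 1) (by omega) h1
      have b2 : e (m + 1) * (f * e m * f) * e (m + 1) = f * e (m + 1) := by
        calc e (m + 1) * (f * e m * f) * e (m + 1) = (e (m + 1) * f) * e m * (f * e (m + 1)) := by
              noncomm_ring
          _ = (f * e (m + 1)) * e m * (e (m + 1) * f) := by rw [b1]
          _ = f * (e (m + 1) * e m * e (m + 1)) * f := by noncomm_ring
          _ = (f * e (m + 1)) * f := by rw [h.braid m h1]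
          _ = _ := by rw [← b1, mul_assoc, I.mul_self, b1]
      have b3 : e (m + 1) * f * e (m + 1) = δ • (f * e (m + 1)) := by
        rw [b1, mul_assoc, h.mul_self _ h1, mul_smul_comm]
      -- The scalar is `δ - u m / u (m + 1)`, which the three-term recursion turns into `u (m + 2) /
      -- u (m + 1)`.
      rw [mul_sub, sub_mul, mul_smul_comm, smul_mul_assoc, b2, b3, ← sub_smul, hu m]
      congr 1
      rw [hc]
      field_simp

/-- A linear functional vanishing on the right ideals and the left ideals generated by the
generators does not distinguish the Jones–Wenzl element from the unit. -/
theorem IsTemperleyLieb.functional_jonesWenzl (h : IsTemperleyLieb P e δ N)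
    (m : ℕ) (hm : m ≤ N) (φ : A →ₗ[K] K)
    (h1 : ∀ i < m, ∀ a, φ (e i * a) = 0) (h2 : ∀ i < m, ∀ a, φ (a * e i) = 0) (a : A) :
    φ (jonesWenzl u P e (m + 1) * a) = φ (P * a) ∧
      φ (a * jonesWenzl u P e (m + 1)) = φ (a * P) := by
  induction m generalizing a with
  | zero => simp [jonesWenzl]
  | succ m ih =>
    have I := fun a => ih (by omega) (fun i hi => h1 i (by omega)) (fun i hi => h2 i (by omega)) a
    rw [jonesWenzl_add_two]
    generalize jonesWenzl u P e (m + 1) = f at *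
    constructor
    · rw [sub_mul, smul_mul_assoc, map_sub, map_smul, (I a).1]
      have : φ (f * e m * f * a) = 0 := by
        rw [mul_assoc, mul_assoc, (I _).1, ← mul_assoc, h.unit_mul m (by omega),
          h1 m (by omega)]
      rw [this]
      simp
    · rw [mul_sub, mul_smul_comm, map_sub, map_smul, (I a).2]
      have : φ (a * (f * e m * f)) = 0 := by
        rw [← mul_assoc, ← mul_assoc, (I _).2, mul_assoc, h.mul_unit m (by omega),
          h2 m (by omega)]
      rw [this]
      simp

/-- Each step of the recursion changes the element only by a term containing a generator. -/
theorem jonesWenzl_sub_unit_mem (I : Submodule K A) (hl : ∀ a, ∀ y ∈ I, a * y ∈ I)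
    (hr : ∀ a, ∀ y ∈ I, y * a ∈ I) (m : ℕ) (he : ∀ i < m, e i ∈ I) :
    jonesWenzl u P e (m + 1) - P ∈ I := by
  induction m with
  | zero => simp [jonesWenzl]
  | succ m ih =>
    rw [jonesWenzl_add_two, sub_right_comm]
    exact I.sub_mem (ih fun i hi => he i (by omega))
      (I.smul_mem _ (hr _ _ (hl _ _ (he m (by omega)))))

end JonesWenzl

/-! ### Special diagrams and the reflection of the Motzkin algebra. -/

namespace MotzkinDiagram

variable {k : ℕ}

/-- The diagram joining the `i`-th top vertex to the `i`-th bottom vertex for `i ∈ S`, all other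
vertices being isolated. -/
def proj (S : Finset (Fin k)) : MotzkinDiagram k := ⟨Matching.proj S, Matching.isPlanar_proj S⟩

/-- The generator of Temperley–Lieb type: horizontal edges joining `i` and `i + 1` in both rows,
vertical edges elsewhere. -/
def cupCap (i : ℕ) (h : i + 1 < k) : MotzkinDiagram k :=
  ⟨Matching.cupCap ⟨i, by omega⟩ ⟨i + 1, h⟩ (by simp), Matching.isPlanar_cupCap _ rfl⟩

/-- The diagram joining the `s a`-th top vertex to the `t a`-th bottom vertex for all `a`, all
other vertices being isolated. -/
noncomputable def rook {n : ℕ} (s t : Fin n ↪o Fin k) : MotzkinDiagram k :=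
  ⟨Matching.rook s t, Matching.isPlanar_rook s t⟩

/-- The reflection of a diagram in the horizontal axis. -/
def flip (d : MotzkinDiagram k) : MotzkinDiagram k :=
  ⟨Matching.flip d.toMatching, Matching.isPlanar_flip d.planar⟩

theorem flip_flip (d : MotzkinDiagram k) : flip (flip d) = d :=
  ext_toMatching (Matching.flip_flip _)

theorem comp_flip (d₁ d₂ : MotzkinDiagram k) : comp (flip d₂) (flip d₁) = flip (comp d₁ d₂) :=
  ext_toMatching (Matching.flip_comp_aux _ _).1

theorem loopNumber_flip (d₁ d₂ : MotzkinDiagram k) :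
    loopNumber (flip d₂) (flip d₁) = loopNumber d₁ d₂ :=
  (Matching.flip_comp_aux _ _).2

instance : Finite (MotzkinDiagram k) :=
  Finite.of_injective (fun d : MotzkinDiagram k => d.partner) fun _ _ h =>
    ext_toMatching (Matching.ext_partner fun v => congrFun h v)

end MotzkinDiagram

namespace MotzkinAlgebra

variable {K : Type*} [Field K] {k : ℕ} {x : K}

instance : Module.Finite K (MotzkinAlgebra K k x) := Module.Finite.of_basis (diagramBasis K k x)

theorem ofDiagram_mul (d₁ d₂ : MotzkinDiagram k) :
    ofDiagram x d₁ * ofDiagram x d₂ =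
      x ^ MotzkinDiagram.loopNumber d₁ d₂ • ofDiagram x (MotzkinDiagram.comp d₁ d₂) :=
  mulMap_ofDiagram d₁ d₂

theorem ofDiagram_mul_of_loopNumber_eq_zero {d₁ d₂ : MotzkinDiagram k}
    (h : MotzkinDiagram.loopNumber d₁ d₂ = 0) :
    ofDiagram x d₁ * ofDiagram x d₂ = ofDiagram x (MotzkinDiagram.comp d₁ d₂) := by
  rw [ofDiagram_mul, h, pow_zero, one_smul]

/-- The linear anti-involution of the Motzkin algebra given by reflecting diagrams. -/
noncomputable def flip : MotzkinAlgebra K k x →ₗ[K] MotzkinAlgebra K k x :=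
  (diagramBasis K k x).constr K fun d => ofDiagram x (MotzkinDiagram.flip d)

theorem flip_ofDiagram (d : MotzkinDiagram k) :
    flip (ofDiagram x d) = ofDiagram x (MotzkinDiagram.flip d) := by
  rw [flip, ← diagramBasis_apply, Module.Basis.constr_basis]

theorem induction_on {p : MotzkinAlgebra K k x → Prop} (a : MotzkinAlgebra K k x)
    (of : ∀ d, p (ofDiagram x d)) (zero : p 0) (add : ∀ u v, p u → p v → p (u + v))
    (smul : ∀ (r : K) u, p u → p (r • u)) : p a := by
  have ha : a ∈ Submodule.span K (Set.range (ofDiagram (k := k) x)) := by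
    rw [span_ofDiagram]; trivial
  induction ha using Submodule.span_induction with
  | mem u hu => obtain ⟨d, rfl⟩ := hu; exact of d
  | zero => exact zero
  | add u v _ _ hu hv => exact add u v hu hv
  | smul r u _ hu => exact smul r u hu

theorem flip_mul (a b : MotzkinAlgebra K k x) : flip (a * b) = flip b * flip a := by
  induction a using induction_on with
  | zero => simp
  | add u v hu hv => rw [add_mul, map_add, hu, hv, map_add, mul_add]
  | smul r u hu => rw [smul_mul_assoc, map_smul, hu, map_smul, mul_smul_comm]
  | of d₁ =>
    induction b using induction_on with
    | zero => simp
    | add u v hu hv => rw [mul_add, map_add, hu, hv, map_add, add_mul]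
    | smul r u hu => rw [mul_smul_comm, map_smul, hu, map_smul, smul_mul_assoc]
    | of d₂ =>
      rw [ofDiagram_mul, map_smul, flip_ofDiagram, flip_ofDiagram, flip_ofDiagram, ofDiagram_mul,
        MotzkinDiagram.comp_flip, MotzkinDiagram.loopNumber_flip]

theorem flip_flip (a : MotzkinAlgebra K k x) : flip (flip a) = a := by
  induction a using induction_on with
  | zero => simp
  | add u v hu hv => rw [map_add, map_add, hu, hv]
  | smul r u hu => rw [map_smul, map_smul, hu]
  | of d => rw [flip_ofDiagram, flip_ofDiagram, MotzkinDiagram.flip_flip]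

/-! ### Relations between dots, projections and cup-caps. -/

section relations

variable (x) in
/-- The element of the Motzkin algebra given by `MotzkinDiagram.proj`. -/
noncomputable def proj (S : Finset (Fin k)) : MotzkinAlgebra K k x :=
  ofDiagram x (MotzkinDiagram.proj S)

variable (k x) in
/-- The idempotent that cuts the `i`-th strand. -/
noncomputable def dot (i : ℕ) : MotzkinAlgebra K k x := proj x {j | (j : ℕ) ≠ i}

variable (k x) in
/-- The generator of Temperley–Lieb type on the strands `i` and `i + 1`. -/
noncomputable def cupCap (i : ℕ) : MotzkinAlgebra K k x :=
  -- The value zero out of range lets most of the relations below hold without a bound on `i`.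
  if h : i + 1 < k then ofDiagram x (MotzkinDiagram.cupCap i h) else 0

theorem flip_proj (S : Finset (Fin k)) : flip (proj x S) = proj x S := by
  rw [proj, flip_ofDiagram]
  congr 1
  exact MotzkinDiagram.ext_toMatching (Matching.flip_proj S)

theorem flip_dot (i : ℕ) : flip (dot k x i) = dot k x i := flip_proj _

theorem flip_cupCap (i : ℕ) : flip (cupCap k x i) = cupCap k x i := by
  unfold cupCap
  split_ifs
  · rw [flip_ofDiagram]
    congr 1
    exact MotzkinDiagram.ext_toMatching (Matching.flip_cupCap (by simp))
  · simp

theorem proj_mul_ofDiagram (S : Finset (Fin k)) (d : MotzkinDiagram k) :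
    proj x S * ofDiagram x d = ofDiagram x (MotzkinDiagram.comp (MotzkinDiagram.proj S) d) :=
  ofDiagram_mul_of_loopNumber_eq_zero (Matching.loopNumber_proj S _)

theorem proj_mul_proj (S T : Finset (Fin k)) : proj x S * proj x T = proj x (S ∩ T) := by
  rw [proj, proj, proj, ← proj, proj_mul_ofDiagram]
  congr 1
  exact MotzkinDiagram.ext_toMatching (Matching.comp_proj_proj S T)

theorem proj_mul_comm (S T : Finset (Fin k)) : proj x S * proj x T = proj x T * proj x S := by
  rw [proj_mul_proj, proj_mul_proj, Finset.inter_comm]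

theorem proj_univ : proj x (Finset.univ : Finset (Fin k)) = 1 := by
  have : MotzkinDiagram.proj (Finset.univ : Finset (Fin k)) = MotzkinDiagram.one k := by
    refine MotzkinDiagram.ext_toMatching (Matching.ext_partner ?_)
    rintro (i | i) <;> simp [MotzkinDiagram.proj, MotzkinDiagram.one, Matching.proj, Matching.one]
  rw [proj, this]
  rfl

theorem dot_mul_dot (i : ℕ) : dot k x i * dot k x i = dot k x i := by
  rw [dot, proj_mul_proj, Finset.inter_self]

theorem dot_eq_proj_compl (i : Fin k) : dot k x i = proj x {i}ᶜ := by
  rw [dot]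
  congr 1
  ext j
  simp [Fin.ext_iff]

theorem dot_mul_ofDiagram (i : Fin k) (d : MotzkinDiagram k)
    (h : d.partner (Sum.inl i) = Sum.inl i) : dot k x i * ofDiagram x d = ofDiagram x d := by
  rw [dot_eq_proj_compl, proj_mul_ofDiagram]
  congr 1
  refine MotzkinDiagram.ext_toMatching (Matching.comp_proj_eq_self fun j hj => ?_)
  obtain rfl : j = i := by simpa using hj
  exact h

/-- A top edge between neighbours can be split off as a dotted cup without a power of `x`, because
the dot breaks the edge before a loop can close. -/
theorem cupCap_mul_dot_mul_ofDiagram {i : ℕ} (h : i + 1 < k) (d : MotzkinDiagram k)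
    (hd : d.partner (Sum.inl ⟨i, by omega⟩) = Sum.inl ⟨i + 1, h⟩) :
    cupCap k x i * (dot k x i * ofDiagram x d) = ofDiagram x d := by
  rw [dot_eq_proj_compl ⟨i, by omega⟩, proj_mul_ofDiagram, cupCap, dif_pos h,
    ofDiagram_mul_of_loopNumber_eq_zero]
  · congr 1
    exact MotzkinDiagram.ext_toMatching (Matching.comp_cupCap_proj_of_edge (by simp) hd)
  · refine Matching.loopNumber_cupCap (by simp) ?_
    have := Matching.comp_proj_partner_inl {(⟨i, by omega⟩ : Fin k)}ᶜ d.toMatching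
      (i := ⟨i, by omega⟩) (by simp)
    simp only [MotzkinDiagram.comp, MotzkinDiagram.proj]
    rw [this]
    simp

/-- This relation is the source of the `-1` in the parameter `x - 1`. -/
theorem cupCap_mul_dot_mul_cupCap (i : ℕ) :
    cupCap k x i * (dot k x i * cupCap k x i) = cupCap k x i := by
  by_cases h : i + 1 < k
  · conv_lhs => rw [cupCap, dif_pos h]
    conv_rhs => rw [cupCap, dif_pos h]
    have := cupCap_mul_dot_mul_ofDiagram (x := x) h (MotzkinDiagram.cupCap i h)
      (by simp [MotzkinDiagram.cupCap, Matching.cupCap])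
    rwa [cupCap, dif_pos h] at this
  · simp [cupCap, h]

theorem cupCap_mul_self (i : ℕ) : cupCap k x i * cupCap k x i = x • cupCap k x i := by
  by_cases h : i + 1 < k
  · rw [cupCap, dif_pos h, ofDiagram_mul]
    have h1 : MotzkinDiagram.loopNumber (MotzkinDiagram.cupCap i h) (MotzkinDiagram.cupCap i h)
        = 1 := Matching.loopNumber_cupCap_self (by simp)
    have h2 : MotzkinDiagram.comp (MotzkinDiagram.cupCap i h) (MotzkinDiagram.cupCap i h)
        = MotzkinDiagram.cupCap i h :=
      MotzkinDiagram.ext_toMatching (Matching.comp_cupCap_self (by simp))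
    rw [h1, h2, pow_one]
  · simp [cupCap, h]

theorem dot_mul_cupCap (i : ℕ) : dot k x (i + 1) * cupCap k x i = dot k x i * cupCap k x i := by
  by_cases h : i + 1 < k
  · rw [cupCap, dif_pos h, dot_eq_proj_compl ⟨i, by omega⟩, dot_eq_proj_compl ⟨i + 1, h⟩,
      proj_mul_ofDiagram, proj_mul_ofDiagram]
    congr 1
    exact MotzkinDiagram.ext_toMatching (Matching.comp_proj_cupCap (by simp)).symm
  · simp [cupCap, h]

theorem cupCap_mul_dot (i : ℕ) : cupCap k x i * dot k x (i + 1) = cupCap k x i * dot k x i := by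
  have := congrArg flip (dot_mul_cupCap (k := k) (x := x) i)
  simpa only [flip_mul, flip_dot, flip_cupCap] using this

theorem proj_mul_cupCap_comm (i : ℕ) (S : Finset (Fin k))
    (h1 : ∀ j : Fin k, (j : ℕ) = i → j ∈ S) (h2 : ∀ j : Fin k, (j : ℕ) = i + 1 → j ∈ S) :
    proj x S * cupCap k x i = cupCap k x i * proj x S := by
  by_cases h : i + 1 < k
  · have e : MotzkinDiagram.comp (MotzkinDiagram.proj S) (MotzkinDiagram.cupCap i h) =
        MotzkinDiagram.comp (MotzkinDiagram.cupCap i h) (MotzkinDiagram.proj S) :=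
      MotzkinDiagram.ext_toMatching (Matching.comp_proj_cupCap_comm (by simp) (h1 _ rfl) (h2 _ rfl))
    rw [cupCap, dif_pos h, proj_mul_ofDiagram, e, proj, ofDiagram_mul_of_loopNumber_eq_zero]
    refine Matching.loopNumber_cupCap (by simp) ?_
    simp [MotzkinDiagram.proj, Matching.proj_inl, h1 ⟨i, _⟩ rfl]
  · simp [cupCap, h]

theorem dot_mul_cupCap_comm {i j : ℕ} (h1 : j ≠ i) (h2 : j ≠ i + 1) :
    dot k x j * cupCap k x i = cupCap k x i * dot k x j :=
  proj_mul_cupCap_comm i _ (by simp; omega) (by simp; omega)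

/-- The three positions are in no prescribed order, so the relation is available with the strands
read from right to left. -/
theorem cupCap_braid_aux {i j l : Fin k} (hij : i ≠ j) (hjl : j ≠ l) (hil : i ≠ l)
    {a b : MotzkinDiagram k} (ha : a.toMatching = Matching.cupCap i j hij)
    (hb : b.toMatching = Matching.cupCap j l hjl) :
    ofDiagram x a * (ofDiagram x b * ofDiagram x a) = ofDiagram x a := by
  have e : MotzkinDiagram.comp a (MotzkinDiagram.comp b a) = a := by
    apply MotzkinDiagram.ext_toMatching
    simp only [MotzkinDiagram.comp, ha, hb]
    exact Matching.comp_cupCap_braid hij hjl hil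
  have h1 : MotzkinDiagram.loopNumber b a = 0 := by
    simp only [MotzkinDiagram.loopNumber, ha, hb]
    refine Matching.loopNumber_cupCap _ ?_
    simp only [Matching.cupCap_inl]
    grind
  have h2 : MotzkinDiagram.loopNumber a (MotzkinDiagram.comp b a) = 0 := by
    simp only [MotzkinDiagram.loopNumber, MotzkinDiagram.comp, ha, hb]
    refine Matching.loopNumber_cupCap _ ?_
    rw [Matching.comp_cupCap_partner]
    simp only [Matching.glue, Matching.glueFun, Matching.cupCap_inl]
    grind
  rw [ofDiagram_mul_of_loopNumber_eq_zero h1, ofDiagram_mul_of_loopNumber_eq_zero h2, e]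

theorem cupCap_braid (i : ℕ) (h : i + 2 < k) :
    cupCap k x (i + 1) * (cupCap k x i * cupCap k x (i + 1)) = cupCap k x (i + 1) := by
  have h1 : i + 1 < k := by omega
  have h2 : i + 1 + 1 < k := h
  rw [cupCap, cupCap, dif_pos h1, dif_pos h2]
  refine cupCap_braid_aux (i := ⟨i + 2, h⟩) (j := ⟨i + 1, h1⟩) (l := ⟨i, by omega⟩) (by simp)
    (by simp) (by simp) ?_ ?_ <;>
  exact Matching.cupCap_symm _ _ (by simp)

theorem cupCap_mul_comm {i j : ℕ} (h : i + 1 < j) :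
    cupCap k x i * cupCap k x j = cupCap k x j * cupCap k x i := by
  by_cases hj : j + 1 < k
  · have hi : i + 1 < k := by omega
    have e : MotzkinDiagram.comp (MotzkinDiagram.cupCap i hi) (MotzkinDiagram.cupCap j hj) =
        MotzkinDiagram.comp (MotzkinDiagram.cupCap j hj) (MotzkinDiagram.cupCap i hi) := by
      refine MotzkinDiagram.ext_toMatching
        (Matching.comp_cupCap_comm (by simp) (by simp) ?_ ?_ ?_ ?_) <;>
      · simp only [ne_eq, Fin.mk.injEq]; omega
    rw [cupCap, cupCap, dif_pos hi, dif_pos hj, ofDiagram_mul_of_loopNumber_eq_zero,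
      ofDiagram_mul_of_loopNumber_eq_zero, e] <;>
    · refine Matching.loopNumber_cupCap (by simp) ?_
      simp only [MotzkinDiagram.cupCap, Matching.cupCap_inl, Fin.mk.injEq]
      split_ifs <;> simp <;> omega
  · simp [cupCap, hj]

end relations

/-! ### Temperley–Lieb relations in a corner. -/

section corner

variable (k x) in
/-- The product of the idempotent cutting all strands but the first `n` ones and of the
complements of the idempotents `dot i`, `i < m`. -/
noncomputable def preCorner (n : ℕ) : ℕ → MotzkinAlgebra K k x
  | 0 => proj x {j | (j : ℕ) < n}
  | m + 1 => preCorner n m - preCorner n m * dot k x m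

variable (k x) in
/-- The idempotent whose corner is the Temperley–Lieb algebra on `n` strands. -/
noncomputable def corner (n : ℕ) : MotzkinAlgebra K k x := preCorner k x n n

theorem proj_mul_preCorner_comm (S : Finset (Fin k)) (n m : ℕ) :
    proj x S * preCorner k x n m = preCorner k x n m * proj x S := by
  induction m with
  | zero => exact proj_mul_comm _ _
  | succ m ih =>
    rw [preCorner, mul_sub, sub_mul, ← mul_assoc, ih, mul_assoc, mul_assoc, dot, proj_mul_comm]

theorem preCorner_mul_eq_self {n m : ℕ} {y : MotzkinAlgebra K k x}
    (h : proj x {j | (j : ℕ) < n} * y = y) (h' : ∀ i < m, dot k x i * y = 0) :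
    preCorner k x n m * y = y := by
  induction m with
  | zero => exact h
  | succ m ih =>
    rw [preCorner, sub_mul, ih fun i hi => h' i (by omega), mul_assoc, h' m (by omega), mul_zero,
      sub_zero]

theorem flip_preCorner (n m : ℕ) : flip (preCorner k x n m) = preCorner k x n m := by
  induction m with
  | zero => exact flip_proj _
  | succ m ih =>
    rw [preCorner, map_sub, flip_mul, ih, flip_dot, dot, proj_mul_preCorner_comm]

theorem flip_corner (n : ℕ) : flip (corner k x n) = corner k x n := flip_preCorner n n

theorem preCorner_mul_dot {n m i : ℕ} (h : i < m) : preCorner k x n m * dot k x i = 0 := by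
  induction m with
  | zero => omega
  | succ m ih =>
    rw [preCorner, sub_mul]
    rcases Nat.lt_succ_iff_lt_or_eq.1 h with h | rfl
    · rw [ih h, mul_assoc, dot, dot, proj_mul_comm, ← mul_assoc, ← dot, ← dot, ih h, zero_mul,
        sub_zero]
    · rw [mul_assoc, dot_mul_dot, sub_self]

theorem proj_mul_preCorner (n m : ℕ) :
    proj x {j | (j : ℕ) < n} * preCorner k x n m = preCorner k x n m := by
  induction m with
  | zero => rw [preCorner, proj_mul_proj, Finset.inter_self]
  | succ m ih => rw [preCorner, mul_sub, ← mul_assoc, ih]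

variable {n : ℕ}

theorem corner_mul_dot {i : ℕ} (h : i < n) : corner k x n * dot k x i = 0 := preCorner_mul_dot h

theorem dot_mul_corner {i : ℕ} (h : i < n) : dot k x i * corner k x n = 0 := by
  rw [dot, corner, proj_mul_preCorner_comm]
  exact corner_mul_dot h

theorem proj_mul_corner : proj x {j | (j : ℕ) < n} * corner k x n = corner k x n :=
  proj_mul_preCorner n n

theorem corner_mul_proj : corner k x n * proj x {j | (j : ℕ) < n} = corner k x n := by
  rw [corner, ← proj_mul_preCorner_comm, proj_mul_preCorner]

theorem corner_mul_corner : corner k x n * corner k x n = corner k x n :=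
  preCorner_mul_eq_self proj_mul_corner fun _ hi => dot_mul_corner hi

theorem mul_corner_eq_self {y : MotzkinAlgebra K k x}
    (h : y * proj x {j | (j : ℕ) < n} = y) (h' : ∀ i < n, y * dot k x i = 0) :
    y * corner k x n = y := by
  have : corner k x n * flip y = flip y := by
    refine preCorner_mul_eq_self ?_ fun i hi => ?_
    · rw [← flip_proj, ← flip_mul, h]
    · rw [← flip_dot, ← flip_mul, h' i hi, map_zero]
  rw [← flip_flip (y * _), flip_mul, flip_corner, this, flip_flip]

theorem cupCap_mul_dot_mul_dot (i : ℕ) :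
    cupCap k x i * dot k x i * dot k x (i + 1) = cupCap k x i * dot k x i := by
  rw [mul_assoc, dot, dot, proj_mul_comm, ← mul_assoc, ← dot, ← dot, cupCap_mul_dot, mul_assoc,
    dot_mul_dot]

/-- Of the right factor `Q` only the complement of the dot at `i` matters: the projection and the
dots at other places pass through `cupCap k x i` and are absorbed by the left `Q`, while the dot at
`i + 1` does the same to `cupCap k x i` as the dot at `i`, or both together. -/
theorem corner_cupCap_corner {i : ℕ} (h : i + 1 < n) :
    corner k x n * cupCap k x i * corner k x n =
      corner k x n * cupCap k x i - corner k x n * cupCap k x i * dot k x i := by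
  set Q := corner k x n with hQ
  have h1 : (Q * cupCap k x i - Q * cupCap k x i * dot k x i) * Q =
      Q * cupCap k x i - Q * cupCap k x i * dot k x i := by
    refine mul_corner_eq_self ?_ fun j hj => ?_
    · have h2 : Q * cupCap k x i * proj x {j | (j : ℕ) < n} = Q * cupCap k x i := by
        rw [mul_assoc, ← proj_mul_cupCap_comm i _ (by simp; omega) (by simp; omega), ← mul_assoc,
          hQ, corner_mul_proj]
      rw [sub_mul, h2, mul_assoc (Q * _), dot, proj_mul_comm, ← mul_assoc, h2]
    · rw [sub_mul]
      by_cases e1 : j = i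
      · subst e1
        rw [mul_assoc _ (dot k x j), dot_mul_dot, sub_self]
      · by_cases e2 : j = i + 1
        · subst e2
          rw [mul_assoc Q, mul_assoc Q, mul_assoc Q, cupCap_mul_dot_mul_dot,
            cupCap_mul_dot, sub_self]
        · have h2 : Q * cupCap k x i * dot k x j = 0 := by
            rw [mul_assoc, ← dot_mul_cupCap_comm e1 e2, ← mul_assoc, hQ, corner_mul_dot hj,
              zero_mul]
          rw [h2, mul_assoc, dot, dot, proj_mul_comm, ← mul_assoc, ← dot, h2]
          simp
  rw [← h1, sub_mul, mul_assoc _ (dot k x i), hQ, dot_mul_corner (by omega), mul_zero, sub_zero]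

theorem corner_cupCap_corner' {i : ℕ} (h : i + 1 < n) :
    corner k x n * cupCap k x i * corner k x n =
      cupCap k x i * corner k x n - dot k x i * (cupCap k x i * corner k x n) := by
  have := congrArg flip (corner_cupCap_corner (k := k) (x := x) h)
  simpa only [flip_mul, flip_dot, flip_cupCap, flip_corner, map_sub, mul_assoc] using this

variable (k x n) in
/-- The Temperley–Lieb generators of the corner. -/
noncomputable def cornerGen (i : ℕ) : MotzkinAlgebra K k x :=
  corner k x n * cupCap k x i * corner k x n

theorem flip_cornerGen (i : ℕ) : flip (cornerGen k x n i) = cornerGen k x n i := by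
  simp only [cornerGen, flip_mul, flip_cupCap, flip_corner, mul_assoc]

/-- The inner `Q` contributes only `1 - dot k x i`; the second term is the correction to the product
in the Motzkin algebra. -/
theorem cornerGen_mul_cornerGen {i j : ℕ} (h : i + 1 < n) :
    cornerGen k x n i * cornerGen k x n j =
      corner k x n * (cupCap k x i * cupCap k x j) * corner k x n -
      corner k x n * (cupCap k x i * dot k x i * cupCap k x j) * corner k x n := by
  have h1 : cornerGen k x n i * cornerGen k x n j =
      (corner k x n * cupCap k x i * corner k x n) * cupCap k x j * corner k x n := by
    rw [cornerGen, cornerGen, mul_assoc (corner k x n * _), ← mul_assoc (corner k x n)]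
    rw [← mul_assoc (corner k x n), corner_mul_corner]
    simp only [mul_assoc]
  rw [h1, corner_cupCap_corner h]
  noncomm_ring

/-- The correction equals `-1` times the generator in its square. In the other relations it
vanishes, because its dot can be moved next to a `Q`. -/
theorem isTemperleyLieb_corner (hn : n ≤ k) :
    IsTemperleyLieb (corner k x n) (cornerGen k x n) (x - 1) (n - 1) := by
  refine ⟨corner_mul_corner, fun i hi => ?_, fun i hi => ?_, fun i hi => ?_, fun i hi => ?_,
    fun i j hij hj => ?_⟩
  · simp only [cornerGen, ← mul_assoc, corner_mul_corner]
  · simp only [cornerGen, mul_assoc, corner_mul_corner]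
  · rw [cornerGen_mul_cornerGen (by omega), cupCap_mul_self, mul_assoc (cupCap k x i),
      cupCap_mul_dot_mul_cupCap, mul_smul_comm, smul_mul_assoc, sub_smul, one_smul, cornerGen]
  · set Q := corner k x n with hQ
    -- The dot moves from the strand `i + 1` to `i` across `cupCap k x i`, then commutes with
    -- `cupCap k x (i + 1)` and meets the left `Q`.
    have z1 : Q * (cupCap k x (i + 1) * dot k x (i + 1) * cupCap k x i) * Q = 0 := by
      rw [mul_assoc (cupCap k x (i + 1)), dot_mul_cupCap, ← mul_assoc (cupCap k x (i + 1)),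
        ← dot_mul_cupCap_comm (by omega) (by omega), mul_assoc (dot k x i), ← mul_assoc Q, hQ,
        corner_mul_dot (by omega), zero_mul, zero_mul]
    -- Next to `cupCap k x i` the dot at `i + 1` can be doubled by one at `i`; the latter commutes
    -- with `cupCap k x (i + 1)` and meets the right `Q`.
    have z2 : cupCap k x i * (dot k x (i + 1) * (cupCap k x (i + 1) * Q)) = 0 := by
      rw [← mul_assoc, cupCap_mul_dot, ← cupCap_mul_dot_mul_dot, mul_assoc, mul_assoc, dot, dot,
        ← mul_assoc (proj x _) (proj x _), proj_mul_comm, mul_assoc, ← dot, ← dot,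
        ← mul_assoc (dot k x i), dot_mul_cupCap_comm (by omega) (by omega), mul_assoc, hQ,
        dot_mul_corner (by omega)]
      simp
    rw [cornerGen_mul_cornerGen (by omega), z1, sub_zero, cornerGen]
    calc Q * (cupCap k x (i + 1) * cupCap k x i) * Q * (Q * cupCap k x (i + 1) * Q)
        = Q * (cupCap k x (i + 1) * cupCap k x i) * ((Q * Q) * cupCap k x (i + 1) * Q) := by
          noncomm_ring
      _ = Q * (cupCap k x (i + 1) * cupCap k x i) * (cupCap k x (i + 1) * Q -
            dot k x (i + 1) * (cupCap k x (i + 1) * Q)) := by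
          rw [hQ, corner_mul_corner, corner_cupCap_corner' (by omega)]
      _ = Q * (cupCap k x (i + 1) * (cupCap k x i * cupCap k x (i + 1))) * Q -
            Q * (cupCap k x (i + 1) *
              (cupCap k x i * (dot k x (i + 1) * (cupCap k x (i + 1) * Q)))) := by
          noncomm_ring
      _ = Q * cupCap k x (i + 1) * Q := by
          rw [z2, cupCap_braid i (by omega)]
          simp
  · rw [cornerGen_mul_cornerGen (by omega), cornerGen_mul_cornerGen (by omega),
      cupCap_mul_comm hij]
    rw [mul_assoc (cupCap k x i), mul_assoc (cupCap k x j),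
      dot_mul_cupCap_comm (by omega) (by omega), dot_mul_cupCap_comm (by omega) (by omega)]
    simp only [mul_assoc]
    rw [dot_mul_corner (by omega), dot_mul_corner (by omega)]
    simp

end corner

end MotzkinAlgebra

/-! ### Consequences of planarity. -/

namespace MotzkinDiagram

variable {k : ℕ} (d : MotzkinDiagram k)

/-- A horizontal edge in the top row below which there are no isolated vertices lies above an edge
joining adjacent vertices. -/
theorem exists_adjacent_edge (r : ℕ)
    (hr : ∀ i : Fin k, (i : ℕ) < r → d.partner (Sum.inl i) ≠ Sum.inl i)
    (n : ℕ) (a b : Fin k) (hn : (b : ℕ) ≤ a + n) (hab : a < b) (hbr : (b : ℕ) < r)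
    (h : d.partner (Sum.inl a) = Sum.inl b) :
    ∃ (i : ℕ) (hi : i + 1 < k), i + 1 < r ∧
      d.partner (Sum.inl ⟨i, by omega⟩) = Sum.inl ⟨i + 1, hi⟩ := by
  have inv := d.invol
  induction n generalizing a b with
  | zero => exact absurd hab (by rw [Fin.lt_def]; omega)
  | succ n ih =>
    rw [Fin.lt_def] at hab
    by_cases hb : (b : ℕ) = a + 1
    · refine ⟨a, by omega, by omega, ?_⟩
      rw [Fin.eta, h]
      congr 1
      exact Fin.ext hb
    -- The right neighbour `c` of `a` is enclosed by the edge from `a` to `b`. Without crossings its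
    -- partner lies strictly between `c` and `b`, which gives a shorter edge.
    · obtain ⟨c, hc⟩ : ∃ c : Fin k, (c : ℕ) = a + 1 := ⟨⟨a + 1, by omega⟩, rfl⟩
      have hba : d.partner (Sum.inl b) = Sum.inl a := by rw [← h, inv]
      have p1 := d.planar (Sum.inl a) (Sum.inl c)
      rw [h] at p1
      have hcc := hr c (by omega)
      rcases he : d.partner (Sum.inl c) with e | e
      · rw [he] at p1 hcc
        have hec : d.partner (Sum.inl e) = Sum.inl c := by rw [← he, inv]
        have p2 := d.planar (Sum.inl e) (Sum.inl a)
        rw [hec, h] at p2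
        simp only [Matching.pos] at p1 p2
        have h1 : (e : ℕ) ≠ c := fun h => hcc (by rw [Fin.ext h])
        have h2 : (e : ℕ) ≠ b := by
          intro h
          rw [Fin.ext h, hba] at hec
          have := congrArg Fin.val (Sum.inl_injective hec)
          omega
        have h3 : (e : ℕ) ≠ a := by
          intro h'
          rw [Fin.ext h', h] at hec
          have := congrArg Fin.val (Sum.inl_injective hec)
          omega
        exact ih c e (by omega) (by rw [Fin.lt_def]; omega) (by omega) he
      · rw [he] at p1
        simp only [Matching.pos] at p1
        omega

/-- Through strands cannot cross, so their lower ends increase strictly from left to right. -/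
theorem le_of_through (r : ℕ)
    (hr : ∀ i : Fin k, (i : ℕ) < r → ∃ j, d.partner (Sum.inl i) = Sum.inr j)
    (n : ℕ) (i j : Fin k) (hin : (i : ℕ) = n) (hi : (i : ℕ) < r)
    (h : d.partner (Sum.inl i) = Sum.inr j) : (i : ℕ) ≤ j := by
  have inv := d.invol
  induction n generalizing i j with
  | zero => omega
  | succ n ih =>
    obtain ⟨a, ha⟩ : ∃ a : Fin k, (a : ℕ) = n := ⟨⟨n, by omega⟩, rfl⟩
    obtain ⟨b, hb⟩ := hr a (by omega)
    have h1 := ih a b ha (by omega) hb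
    have h2 := d.planar (Sum.inl a) (Sum.inl i)
    rw [h, hb] at h2
    simp only [Matching.pos] at h2
    have h3 : b ≠ j := by
      rintro rfl
      have h4 : (Sum.inl a : Fin k ⊕ Fin k) = Sum.inl i := by
        rw [← inv (Sum.inl a), hb, ← h, inv]
      have := congrArg Fin.val (Sum.inl_injective h4)
      omega
    have h4 : (b : ℕ) ≠ j := fun h => h3 (Fin.ext h)
    omega

/-- The preceding bound, applied to `d` and to its reflection, forces every through strand to be
vertical. It also compares `r` with `s`, since the first vertex beyond the smaller row would have to
go strictly to the left. -/
theorem eq_proj_of_through {r s : ℕ} (hrk : r ≤ k) (hsk : s ≤ k)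
    (h1 : ∀ i : Fin k, (i : ℕ) < r → ∃ j : Fin k, (j : ℕ) < s ∧ d.partner (Sum.inl i) = Sum.inr j)
    (h2 : ∀ j : Fin k, (j : ℕ) < s → ∃ i : Fin k, (i : ℕ) < r ∧ d.partner (Sum.inr j) = Sum.inl i)
    (h3 : ∀ i : Fin k, r ≤ i → d.partner (Sum.inl i) = Sum.inl i)
    (h4 : ∀ j : Fin k, s ≤ j → d.partner (Sum.inr j) = Sum.inr j) :
    r = s ∧ d = proj {j | (j : ℕ) < r} := by
  have inv := d.invol
  have hge : ∀ i j : Fin k, (i : ℕ) < r → d.partner (Sum.inl i) = Sum.inr j → (i : ℕ) ≤ j :=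
    fun i j hi hij => d.le_of_through r
      (fun i hi => (h1 i hi).imp fun _ h => h.2) i i j rfl hi hij
  have hle : ∀ i j : Fin k, (j : ℕ) < s → d.partner (Sum.inr j) = Sum.inl i → (j : ℕ) ≤ i := by
    intro i j hj hij
    refine (flip d).le_of_through s (fun j hj => ?_) j j i rfl hj ?_
    · obtain ⟨i, -, hi⟩ := h2 j hj
      exact ⟨i, by simp [flip, Matching.flip, hi]⟩
    · simp [flip, Matching.flip, hij]
  have hrs : r ≤ s := by
    by_contra hlt
    obtain ⟨j, hj, hj'⟩ := h1 ⟨s, by omega⟩ (by simp only; omega)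
    have := hge _ _ (by simp only; omega) hj'
    simp only at this
    omega
  have hsr : s ≤ r := by
    by_contra hlt
    obtain ⟨j, hj, hj'⟩ := h2 ⟨r, by omega⟩ (by simp only; omega)
    have := hle _ _ (by simp only; omega) hj'
    simp only at this
    omega
  obtain rfl : r = s := le_antisymm hrs hsr
  have key : ∀ i : Fin k, (i : ℕ) < r → d.partner (Sum.inl i) = Sum.inr i := by
    intro i hi
    obtain ⟨j, hj, hij⟩ := h1 i hi
    have l1 := hge i j hi hij
    have l2 := hle i j hj (by rw [← hij, inv])
    rw [hij, Fin.ext (le_antisymm l1 l2)]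
  refine ⟨rfl, ext_toMatching (Matching.ext_partner ?_)⟩
  rintro (i | i)
  · by_cases hi : (i : ℕ) < r
    · simp [proj, Matching.proj_inl, key i hi, hi]
    · simp [proj, Matching.proj_inl, h3 i (not_lt.1 hi), hi]
  · by_cases hi : (i : ℕ) < r
    · have : d.partner (Sum.inr i) = Sum.inl i := by rw [← key i hi, inv]
      simp [proj, Matching.proj_inr, this, hi]
    · simp [proj, Matching.proj_inr, h4 i (not_lt.1 hi), hi]

end MotzkinDiagram

/-! ### Diagrams between elements killed by dots and dotted cups. -/

namespace MotzkinAlgebra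

variable {K : Type*} [Field K] {k : ℕ} {x : K}

/-- Projections create no loops, so a single diagram without a scalar results; the right factor is
treated by reflection. -/
theorem exists_proj_mul_ofDiagram_mul_proj (S T : Finset (Fin k)) (d : MotzkinDiagram k) :
    ∃ d' : MotzkinDiagram k, proj x S * ofDiagram x d * proj x T = ofDiagram x d' ∧
      (∀ i ∉ S, d'.partner (Sum.inl i) = Sum.inl i) ∧
      ∀ i ∉ T, d'.partner (Sum.inr i) = Sum.inr i := by
  set d₁ := MotzkinDiagram.comp (MotzkinDiagram.proj S) d with hd₁
  set d₂ := MotzkinDiagram.comp (MotzkinDiagram.proj T) (MotzkinDiagram.flip d₁) with hd₂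
  have e2 : MotzkinDiagram.flip d₂ = MotzkinDiagram.comp d₁ (MotzkinDiagram.proj T) := by
    have hf : MotzkinDiagram.flip (MotzkinDiagram.proj T) = MotzkinDiagram.proj T :=
      MotzkinDiagram.ext_toMatching (Matching.flip_proj T)
    rw [hd₂, ← MotzkinDiagram.comp_flip, MotzkinDiagram.flip_flip, hf]
  refine ⟨MotzkinDiagram.flip d₂, ?_, fun i hi => ?_, fun i hi => ?_⟩
  · rw [proj_mul_ofDiagram, ← flip_ofDiagram, hd₂]
    have h := proj_mul_ofDiagram (x := x) T (MotzkinDiagram.flip d₁)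
    rw [← h, flip_mul, flip_proj, flip_ofDiagram, MotzkinDiagram.flip_flip]
  · rw [e2]
    exact Matching.comp_partner_top (Matching.comp_proj_partner_inl S d.toMatching hi)
  · have := Matching.comp_proj_partner_inl T (MotzkinDiagram.flip d₁).toMatching hi
    simp only [MotzkinDiagram.flip, Matching.flip, Sum.swap_inr, hd₂, MotzkinDiagram.comp,
      MotzkinDiagram.proj] at this ⊢
    rw [this, Sum.swap_inl]

/-- Diagrams act between elements that are killed by all cups and caps as multiples of the
identity. -/
theorem mul_ofDiagram_mul {r s : ℕ} (hr : r ≤ k) (hs : s ≤ k) {F G : MotzkinAlgebra K k x}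
    (hF : F * corner k x r = F) (hG : corner k x s * G = G)
    (hF' : ∀ i, i + 1 < r → F * (cupCap k x i * dot k x i) = 0)
    (hG' : ∀ i, i + 1 < s → dot k x i * cupCap k x i * G = 0) (d : MotzkinDiagram k) :
    F * ofDiagram x d * G = 0 ∨ r = s ∧ F * ofDiagram x d * G = F * G := by
  have hFR : F * proj x {j | (j : ℕ) < r} = F := by
    rw [← hF, mul_assoc, corner_mul_proj]
  have hGR : proj x {j | (j : ℕ) < s} * G = G := by
    rw [← hG, ← mul_assoc, proj_mul_corner]
  have hFd : ∀ i, i < r → F * dot k x i = 0 := fun i hi => by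
    rw [← hF, mul_assoc, corner_mul_dot hi, mul_zero]
  have hGd : ∀ i, i < s → dot k x i * G = 0 := fun i hi => by
    rw [← hG, ← mul_assoc, dot_mul_corner hi, zero_mul]
  obtain ⟨d', e, ht, hb⟩ := exists_proj_mul_ofDiagram_mul_proj (x := x)
    {j : Fin k | (j : ℕ) < r} {j : Fin k | (j : ℕ) < s} d
  have e' : F * ofDiagram x d * G = F * ofDiagram x d' * G := by
    rw [← e]
    nth_rw 1 [← hFR, ← hGR]
    simp only [mul_assoc]
  rw [e']
  have ht' : ∀ i : Fin k, r ≤ i → d'.partner (Sum.inl i) = Sum.inl i :=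
    fun i hi => ht i (by simpa using hi)
  have hb' : ∀ i : Fin k, s ≤ i → d'.partner (Sum.inr i) = Sum.inr i :=
    fun i hi => hb i (by simpa using hi)
  have inv := d'.invol
  have hfl : flip (ofDiagram x (MotzkinDiagram.flip d')) = ofDiagram x d' := by
    rw [flip_ofDiagram, MotzkinDiagram.flip_flip]
  have pfl : ∀ v, (MotzkinDiagram.flip d').partner v = (d'.partner v.swap).swap := fun v => rfl
  -- An isolated vertex within the first `r` lets a dot be split off, and `F` kills it; likewise for
  -- `G` at the bottom.
  by_cases c1 : ∃ i : Fin k, (i : ℕ) < r ∧ d'.partner (Sum.inl i) = Sum.inl i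
  · obtain ⟨i, hi, h⟩ := c1
    left
    rw [← dot_mul_ofDiagram i d' h, ← mul_assoc F, hFd i hi, zero_mul, zero_mul]
  by_cases c2 : ∃ i : Fin k, (i : ℕ) < s ∧ d'.partner (Sum.inr i) = Sum.inr i
  · obtain ⟨i, hi, h⟩ := c2
    left
    have := dot_mul_ofDiagram (x := x) i (MotzkinDiagram.flip d') (by simp [pfl, h])
    rw [← hfl, ← this, flip_mul, hfl, flip_dot, mul_assoc, mul_assoc, hGd i hi, mul_zero, mul_zero]
  push Not at c1 c2
  by_cases c3 : ∃ a b : Fin k, (a : ℕ) < r ∧ d'.partner (Sum.inl a) = Sum.inl b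
  · obtain ⟨a, b, ha, hab⟩ := c3
    left
    have hba : d'.partner (Sum.inl b) = Sum.inl a := by rw [← hab, inv]
    have hne : a ≠ b := by rintro rfl; exact c1 a ha hab
    have hbr : (b : ℕ) < r := by
      by_contra h
      rw [ht' b (not_lt.1 h)] at hba
      exact hne (Sum.inl_injective hba).symm
    obtain ⟨i, hi, hir, h⟩ : ∃ (i : ℕ) (hi : i + 1 < k), i + 1 < r ∧
        d'.partner (Sum.inl ⟨i, by omega⟩) = Sum.inl ⟨i + 1, hi⟩ := by
      rcases lt_or_gt_of_ne hne with h | h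
      · exact d'.exists_adjacent_edge r c1 b a b (by omega) h hbr hab
      · exact d'.exists_adjacent_edge r c1 a b a (by omega) h ha hba
    rw [← cupCap_mul_dot_mul_ofDiagram hi d' h, ← mul_assoc, ← mul_assoc, mul_assoc F, hF' i hir,
      zero_mul, zero_mul]
  by_cases c4 : ∃ a b : Fin k, (a : ℕ) < s ∧ d'.partner (Sum.inr a) = Sum.inr b
  · obtain ⟨a, b, ha, hab⟩ := c4
    left
    have hba : d'.partner (Sum.inr b) = Sum.inr a := by rw [← hab, inv]
    have hne : a ≠ b := by rintro rfl; exact c2 a ha hab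
    have hbs : (b : ℕ) < s := by
      by_contra h
      rw [hb' b (not_lt.1 h)] at hba
      exact hne (Sum.inr_injective hba).symm
    have c2' : ∀ i : Fin k, (i : ℕ) < s →
        (MotzkinDiagram.flip d').partner (Sum.inl i) ≠ Sum.inl i := by
      intro i hi h
      rw [pfl, Sum.swap_inl] at h
      exact c2 i hi (by rw [← Sum.swap_swap (d'.partner _), h, Sum.swap_inl])
    obtain ⟨i, hi, his, h⟩ : ∃ (i : ℕ) (hi : i + 1 < k), i + 1 < s ∧
        (MotzkinDiagram.flip d').partner (Sum.inl ⟨i, by omega⟩) = Sum.inl ⟨i + 1, hi⟩ := by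
      rcases lt_or_gt_of_ne hne with h | h
      · exact MotzkinDiagram.exists_adjacent_edge _ s c2' b a b (by omega) h hbs
          (by simp [pfl, hab])
      · exact MotzkinDiagram.exists_adjacent_edge _ s c2' a b a (by omega) h ha
          (by simp [pfl, hba])
    have := congrArg flip (cupCap_mul_dot_mul_ofDiagram (x := x) hi (MotzkinDiagram.flip d') h)
    rw [flip_mul, flip_mul, hfl, flip_dot, flip_cupCap, mul_assoc] at this
    rw [← this, mul_assoc, mul_assoc, hG' i his, mul_zero, mul_zero]
  push Not at c3 c4
  -- Only through strands remain, so `d'` is the projection that `F` absorbs.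
  obtain ⟨rfl, e''⟩ := d'.eq_proj_of_through (r := r) (s := s) hr hs (by
      intro i hi
      rcases h : d'.partner (Sum.inl i) with j | j
      · exact absurd h (c3 i j hi)
      · refine ⟨j, ?_, rfl⟩
        by_contra hj
        have := hb' j (not_lt.1 hj)
        rw [← h, inv, h] at this
        cases this) (by
      intro i hi
      rcases h : d'.partner (Sum.inr i) with j | j
      · refine ⟨j, ?_, rfl⟩
        by_contra hj
        have := ht' j (not_lt.1 hj)
        rw [← h, inv, h] at this
        cases this
      · exact absurd h (c4 i j hi)) ht' hb'
  refine Or.inr ⟨rfl, ?_⟩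
  rw [e'']
  change F * proj x _ * G = _
  rw [hFR]

/-- It passes from `F * cornerGen k x n i = 0` to the vanishing on the dotted cup when `x ≠ 1`. The
scalar comes from `cupCap` squared, which gives `x`, less the dotted product, which gives `1`. -/
theorem mul_cornerGen_mul {n i : ℕ} (h : i + 1 < n) {F : MotzkinAlgebra K k x}
    (hF : F * corner k x n = F) :
    F * cornerGen k x n i * (cupCap k x i * dot k x i) =
      (x - 1) • (F * (cupCap k x i * dot k x i)) := by
  have e : F * corner k x n * (cupCap k x i * (dot k x i * cupCap k x i)) * dot k x i =
      F * (cupCap k x i * dot k x i) := by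
    rw [cupCap_mul_dot_mul_cupCap, hF, mul_assoc]
  have e2 : F * corner k x n * (cupCap k x i * cupCap k x i) * dot k x i =
      x • (F * (cupCap k x i * dot k x i)) := by
    rw [cupCap_mul_self, hF, mul_smul_comm, smul_mul_assoc, mul_assoc]
  rw [cornerGen, corner_cupCap_corner h, sub_smul, one_smul]
  refine Eq.trans ?_ (congrArg₂ (· - ·) e2 e)
  noncomm_ring

/-- The Jones–Wenzl element on the first `n` strands. -/
noncomputable def jw (u : ℕ → K) (n m : ℕ) : MotzkinAlgebra K k x :=
  jonesWenzl u (corner k x n) (cornerGen k x n) m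

theorem flip_jw (u : ℕ → K) (n m : ℕ) :
    flip (jw u n m : MotzkinAlgebra K k x) = jw u n m := by
  induction m using Nat.strong_induction_on with
  | _ m ih =>
    match m, ih with
    | 0, _ => exact flip_corner n
    | 1, _ => exact flip_corner n
    | m + 2, ih =>
      have := ih (m + 1) (by omega)
      rw [jw] at this ⊢
      rw [jonesWenzl_add_two, map_sub, map_smul, flip_mul, flip_mul, this, flip_cornerGen,
        mul_assoc]

theorem dot_mul_cupCap_mul_eq_zero {i : ℕ} {F : MotzkinAlgebra K k x} (hF : flip F = F)
    (h : F * (cupCap k x i * dot k x i) = 0) : dot k x i * cupCap k x i * F = 0 := by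
  rw [← flip_flip (_ * F), flip_mul, flip_mul (dot k x i), hF, flip_cupCap, flip_dot, h, map_zero]

/-! ### Jones–Wenzl elements generate the algebra as an ideal. -/

section generation

theorem rook_mul_rook {n : ℕ} (s t v : Fin n ↪o Fin k) :
    ofDiagram x (MotzkinDiagram.rook s t) * ofDiagram x (MotzkinDiagram.rook t v) =
      ofDiagram x (MotzkinDiagram.rook s v) := by
  rw [ofDiagram_mul_of_loopNumber_eq_zero
    (d₁ := MotzkinDiagram.rook s t) (Matching.loopNumber_rook s t _)]
  congr 1
  exact MotzkinDiagram.ext_toMatching (Matching.comp_rook s t v)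

theorem ofDiagram_rook_self {n : ℕ} (s : Fin n ↪o Fin k) :
    ofDiagram x (MotzkinDiagram.rook s s) = proj x (Finset.univ.map s.toEmbedding) := by
  rw [proj]
  congr 1
  exact MotzkinDiagram.ext_toMatching (Matching.rook_self s)

variable {u : ℕ → K} (I : Submodule K (MotzkinAlgebra K k x))

/-- The Jones–Wenzl elements generate the Motzkin algebra as a two-sided ideal. -/
theorem one_mem_of_jw_mem (hl : ∀ a, ∀ y ∈ I, a * y ∈ I) (hr : ∀ a, ∀ y ∈ I, y * a ∈ I)
    (hI : ∀ n ≤ k, jw u n n ∈ I) : 1 ∈ I := by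
  have key : ∀ n, ∀ S : Finset (Fin k), S.card = n → proj x S ∈ I := by
    intro n
    induction n using Nat.strong_induction_on with
    | _ n ih =>
    intro S hS
    have hn : n ≤ k := by
      have := Finset.card_le_univ S
      rw [Fintype.card_fin] at this
      omega
    set R : Finset (Fin k) := {j | (j : ℕ) < n} with hR
    have hRc : R = Finset.univ.map (Fin.castLEOrderEmb hn).toEmbedding := by
      ext j
      simp only [hR, Finset.mem_filter, Finset.mem_univ, true_and, Finset.mem_map]
      constructor
      · intro hj
        exact ⟨⟨j, hj⟩, rfl⟩
      · rintro ⟨i, rfl⟩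
        exact i.2
    have hcard : R.card = n := by rw [hRc]; simp
    -- A dot leaves a projection to fewer strands, covered by the induction on the cardinality.
    have hdot : ∀ m < n, proj x R * dot k x m ∈ I := by
      intro m hm
      rw [dot, proj_mul_proj]
      refine ih _ ?_ _ rfl
      rw [← hcard]
      refine Finset.card_lt_card (Finset.ssubset_iff_of_subset Finset.inter_subset_left |>.2
        ⟨⟨m, by omega⟩, ?_, ?_⟩)
      · simpa [hR] using hm
      · simp
    have hpre : ∀ m ≤ n, preCorner k x n m - proj x R ∈ I := by
      intro m
      induction m with
      | zero => intro _; simp [preCorner, hR]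
      | succ m ihm =>
        intro hm
        rw [preCorner, sub_right_comm]
        refine I.sub_mem (ihm (by omega)) ?_
        rw [← proj_mul_preCorner, proj_mul_preCorner_comm, mul_assoc]
        exact hl _ _ (hdot m (by omega))
    -- A generator factors through its dotted form, and the projection commutes with `cupCap k x i`
    -- until it meets the dot.
    have hgen : ∀ i, i + 1 < n → cornerGen k x n i ∈ I := by
      intro i hi
      rw [cornerGen, ← cupCap_mul_dot_mul_cupCap, ← corner_mul_proj, ← mul_assoc (cupCap k x i),
        ← mul_assoc, ← mul_assoc, mul_assoc (corner k x n),
        ← mul_assoc (proj x _), proj_mul_cupCap_comm i _ (by simp; omega) (by simp; omega),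
        mul_assoc (cupCap k x i)]
      exact hr _ _ (hr _ _ (hr _ _ (hl _ _ (hl _ _ (hdot i (by omega))))))
    have hjw : jw u n n - corner k x n ∈ I := by
      rcases n with _ | n
      · simp [jw, jonesWenzl]
      · exact jonesWenzl_sub_unit_mem I hl hr n fun i hi => hgen i (by omega)
    have hRI : proj x R ∈ I := by
      have h1 := I.sub_mem (hI n hn) hjw
      rw [sub_sub_cancel] at h1
      have h2 := I.sub_mem h1 (hpre n le_rfl)
      rwa [corner, sub_sub_cancel] at h2
    -- Rook diagrams carry `S` to the initial segment `R` of the same size, so `proj x S` lies in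
    -- the ideal generated by `proj x R`.
    have hSe : S = Finset.univ.map (S.orderEmbOfFin hS).toEmbedding := by
      apply Finset.coe_injective
      simp
    rw [hSe, ← ofDiagram_rook_self, ← rook_mul_rook _ (Fin.castLEOrderEmb hn),
      ← rook_mul_rook (Fin.castLEOrderEmb hn) (Fin.castLEOrderEmb hn), ofDiagram_rook_self, ← hRc]
    exact hl _ _ (hr _ _ hRI)
  rw [← proj_univ]
  exact key _ _ rfl

end generation

/-! ### Semisimplicity when no relevant `u j` vanishes. -/

section semisimple

variable {u : ℕ → K}

/-- The radical vanishes between any two Jones–Wenzl elements, and these generate the unit ideal, so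
it vanishes. -/
theorem isSemisimpleRing_of_ne_zero (hu0 : u 0 = 1) (hu1 : u 1 = x - 1)
    (hu : ∀ m, u (m + 2) = (x - 1) * u (m + 1) - u m)
    (hne : ∀ j, 1 ≤ j → j ≤ k - 1 → u j ≠ 0) : IsSemisimpleRing (MotzkinAlgebra K k x) := by
  have hart : IsArtinianRing (MotzkinAlgebra K k x) := IsArtinianRing.of_finite K _
  rw [IsArtinianRing.isSemisimpleRing_iff_jacobson]
  set J := Ring.jacobson (MotzkinAlgebra K k x) with hJ
  let F : ℕ → MotzkinAlgebra K k x := fun n => jw u n n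
  have hprop : ∀ n ≤ k, F n * corner k x n = F n ∧ F n * F n = F n ∧
      ∀ i, i + 1 < n → F n * cornerGen k x n i = 0 := by
    intro n hn
    rcases n with _ | n
    · exact ⟨corner_mul_corner, corner_mul_corner, by simp⟩
    · have := (isTemperleyLieb_corner (x := x) hn).jonesWenzlProperties hu0 hu1 hu n (by omega)
        fun j h1 h2 => hne j h1 (by omega)
      exact ⟨this.mul_unit, this.mul_self, fun i hi => this.mul_gen i (by omega)⟩
  have hflip : ∀ n, flip (F n) = F n := fun n => flip_jw u n n
  have hcup : ∀ n ≤ k, ∀ i, i + 1 < n → F n * (cupCap k x i * dot k x i) = 0 := by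
    intro n hn i hi
    have h1 := mul_cornerGen_mul hi (hprop n hn).1
    rw [(hprop n hn).2.2 i hi, zero_mul] at h1
    -- A generator exists only if `k ≥ 2`, and then `u 1 = x - 1` is among the values assumed
    -- nonzero.
    have h2 : x - 1 ≠ 0 := hu1 ▸ hne 1 le_rfl (by omega)
    exact (smul_eq_zero.1 h1.symm).resolve_left h2
  have hcorner : ∀ n ≤ k, corner k x n * F n = F n := by
    intro n hn
    rw [← flip_flip (_ * F n), flip_mul, hflip, flip_corner, (hprop n hn).1, hflip]
  have hdiag : ∀ r ≤ k, ∀ s ≤ k, ∀ a, ∃ c : K, F r * a * F s = c • F r ∧ (c ≠ 0 → r = s) := by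
    intro r hr s hs a
    induction a using induction_on with
    | zero => exact ⟨0, by simp⟩
    | add a b ha hb =>
      obtain ⟨c, hc, hc'⟩ := ha
      obtain ⟨c₂, hc₂, hc₂'⟩ := hb
      refine ⟨c + c₂, by rw [mul_add, add_mul, hc, hc₂, add_smul], fun h => ?_⟩
      by_cases h0 : c = 0
      · exact hc₂' fun h' => h (by rw [h0, h', add_zero])
      · exact hc' h0
    | smul t a ha =>
      obtain ⟨c, hc, hc'⟩ := ha
      refine ⟨t * c, by rw [mul_smul_comm, smul_mul_assoc, hc, smul_smul], fun h => ?_⟩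
      exact hc' (right_ne_zero_of_mul h)
    | of d =>
      rcases mul_ofDiagram_mul hr hs (hprop r hr).1 (hcorner s hs) (hcup r hr)
        (fun i hi => dot_mul_cupCap_mul_eq_zero (hflip s) (hcup s hs i hi)) d with h | ⟨rfl, h⟩
      · exact ⟨0, by simp [h]⟩
      · exact ⟨1, by rw [h, (hprop r hr).2.1, one_smul], fun _ => rfl⟩
  have hzero : ∀ r ≤ k, ∀ s ≤ k, ∀ a ∈ J, F r * a * F s = 0 := by
    intro r hr s hs a ha
    obtain ⟨c, hc, hc'⟩ := hdiag r hr s hs a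
    by_cases h0 : c = 0
    · rw [hc, h0, zero_smul]
    · have h1 : F r * a * F s ∈ J := J.mul_mem_right _ (J.mul_mem_left _ ha)
      have h2 : F r ∈ J := by
        have h3 := J.mul_mem_left (algebraMap K _ c⁻¹) h1
        rwa [hc, ← Algebra.smul_def, smul_smul, inv_mul_cancel₀ h0, one_smul] at h3
      have h4 : F r = 0 := by
        rw [hJ, ← Ideal.jacobson_bot, Ideal.mem_jacobson_iff] at h2
        -- For an element `F r` of the radical, `1 - F r` has a left inverse; since `(1 - F r) * F r
        -- = 0`, the idempotent is zero.
        obtain ⟨z, hz⟩ := h2 (-1)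
        rw [Ideal.mem_bot, sub_eq_zero] at hz
        have := congrArg (· * F r) hz
        simpa [add_mul, mul_assoc, (hprop r hr).2.1] using this.symm
      rw [hc, h4, smul_zero]
  -- The `y` annihilating all `a * b * F s` with `a ∈ J` form a two-sided ideal containing every `F
  -- n`, hence `1`. The free factor `b` makes this set stable under right multiplication.
  have step1 : ∀ s ≤ k, ∀ a ∈ J, ∀ b, a * b * F s = 0 := by
    intro s hs
    let I : Submodule K (MotzkinAlgebra K k x) :=
      { carrier := {y | ∀ a ∈ J, ∀ b, y * a * b * F s = 0}
        add_mem' := by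
          intro y z hy hz a ha b
          simp only [add_mul, hy a ha b, hz a ha b, add_zero]
        zero_mem' := by simp
        smul_mem' := by
          intro c y hy a ha b
          simp only [smul_mul_assoc, hy a ha b, smul_zero] }
    have h1 : (1 : MotzkinAlgebra K k x) ∈ I := by
      refine one_mem_of_jw_mem (u := u) I ?_ ?_ ?_
      · intro c y hy a ha b
        rw [mul_assoc c, mul_assoc c, mul_assoc c, hy a ha b, mul_zero]
      · intro c y hy a ha b
        rw [mul_assoc y]
        exact hy _ (J.mul_mem_left _ ha) b
      · intro n hn a ha b
        rw [mul_assoc (jw u n n)]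
        exact hzero n hn s hs _ (J.mul_mem_right _ ha)
    intro a ha b
    simpa using h1 a ha b
  -- The same argument on the other side: the right annihilator of `J` contains every `F n`, hence
  -- `1`.
  let I : Submodule K (MotzkinAlgebra K k x) :=
    { carrier := {y | ∀ a ∈ J, a * y = 0}
      add_mem' := by
        intro y z hy hz a ha
        rw [mul_add, hy a ha, hz a ha, add_zero]
      zero_mem' := by simp
      smul_mem' := by
        intro c y hy a ha
        rw [mul_smul_comm, hy a ha, smul_zero] }
  have h1 : (1 : MotzkinAlgebra K k x) ∈ I := by
    refine one_mem_of_jw_mem (u := u) I ?_ ?_ ?_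
    · intro c y hy a ha
      rw [← mul_assoc]
      exact hy _ (J.mul_mem_right _ ha)
    · intro c y hy a ha
      rw [← mul_assoc, hy a ha, zero_mul]
    · intro n hn a ha
      simpa using step1 n hn a ha 1
  rw [eq_bot_iff]
  intro a ha
  simpa using h1 a ha

/-! ### A nilpotent obstruction at the first zero of `u`. -/

/-- In a semisimple ring, `z` vanishes if `z * a * z = 0` for all `a`. -/
theorem eq_zero_of_mul_mul_eq_zero {R : Type*} [Ring R] [IsSemisimpleRing R] {z : R}
    (h : ∀ a, z * a * z = 0) : z = 0 := by
  obtain ⟨e, he, hz⟩ := IsSemisimpleRing.ideal_eq_span_idempotent (Ideal.span {z})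
  obtain ⟨a, ha⟩ := Ideal.mem_span_singleton'.1 (hz ▸ Ideal.mem_span_singleton_self e)
  obtain ⟨b, hb⟩ := Ideal.mem_span_singleton'.1 (hz ▸ Ideal.mem_span_singleton_self z)
  have : e = 0 := by
    rw [← he.eq, ← ha, mul_assoc, ← mul_assoc z, h, mul_zero]
  rw [← hb, this, mul_zero]

/-- The diagram with an edge joining `m` and `m + 1` in both rows, vertical edges on the first `m`
places, and isolated vertices elsewhere. -/
def lastCupCap (m : ℕ) (h : m + 1 < k) : MotzkinDiagram k :=
  MotzkinDiagram.comp (MotzkinDiagram.proj {j | (j : ℕ) < m + 2}) (MotzkinDiagram.cupCap m h)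

variable {m : ℕ} (hm : m + 1 < k)

theorem ofDiagram_lastCupCap :
    ofDiagram x (lastCupCap m hm) = proj x {j | (j : ℕ) < m + 2} * cupCap k x m := by
  rw [cupCap, dif_pos hm, proj_mul_ofDiagram, lastCupCap]

theorem flip_lastCupCap : MotzkinDiagram.flip (lastCupCap m hm) = lastCupCap m hm := by
  rw [lastCupCap, ← MotzkinDiagram.comp_flip]
  have h1 : MotzkinDiagram.flip (MotzkinDiagram.cupCap m hm) = MotzkinDiagram.cupCap m hm :=
    MotzkinDiagram.ext_toMatching (Matching.flip_cupCap (by simp))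
  have h2 : ∀ T : Finset (Fin k), MotzkinDiagram.flip (MotzkinDiagram.proj T) =
    MotzkinDiagram.proj T := fun T => MotzkinDiagram.ext_toMatching (Matching.flip_proj T)
  rw [h1, h2]
  exact MotzkinDiagram.ext_toMatching
    (Matching.comp_proj_cupCap_comm (by simp) (by simp) (by simp)).symm

theorem lastCupCap_partner (i : Fin k) (hi : (i : ℕ) < m + 2) :
    (lastCupCap m hm).partner (Sum.inl i) =
      (Matching.cupCap (⟨m, by omega⟩ : Fin k) ⟨m + 1, hm⟩ (by simp)).partner (Sum.inl i) := by
  refine (Matching.comp_proj_partner _ _ _).trans (if_neg ?_)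
  rintro ⟨j, hj, h⟩
  simp only [Finset.mem_filter, Finset.mem_univ, true_and, not_lt] at hj
  rcases h with h | h
  · obtain rfl := Sum.inl_injective h
    omega
  · simp only [MotzkinDiagram.cupCap, Matching.cupCap_inl, Fin.ext_iff] at h
    split_ifs at h <;> (have := congrArg Fin.val (Sum.inl_injective h); simp at this; omega)

variable (x) in
/-- The coefficient of `lastCupCap`. -/
noncomputable def lastCoeff : MotzkinAlgebra K k x →ₗ[K] K :=
  (diagramBasis K k x).coord (lastCupCap m hm)

theorem lastCoeff_ofDiagram (d : MotzkinDiagram k) [Decidable (d = lastCupCap m hm)] :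
    lastCoeff x hm (ofDiagram x d) = if d = lastCupCap m hm then 1 else 0 := by
  rw [lastCoeff, ← diagramBasis_apply, Module.Basis.coord_apply, Module.Basis.repr_self,
    Finsupp.single_apply]

theorem lastCoeff_flip (a : MotzkinAlgebra K k x) :
    lastCoeff x hm (flip a) = lastCoeff x hm a := by
  classical
  induction a using induction_on with
  | zero => simp
  | add a b ha hb => rw [map_add, map_add, map_add, ha, hb]
  | smul r a ha => rw [map_smul, map_smul, map_smul, ha]
  | of d =>
    rw [flip_ofDiagram, lastCoeff_ofDiagram, lastCoeff_ofDiagram]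
    congr 1
    rw [eq_iff_iff]
    constructor
    · intro h
      rw [← MotzkinDiagram.flip_flip d, h, flip_lastCupCap]
    · rintro rfl
      exact flip_lastCupCap hm

/-- `lastCupCap` has no isolated vertex among the first `m + 2` top vertices. -/
theorem lastCoeff_dot_mul {i : ℕ} (hi : i < m + 2) (a : MotzkinAlgebra K k x) :
    lastCoeff x hm (dot k x i * a) = 0 := by
  classical
  induction a using induction_on with
  | zero => simp
  | add a b ha hb => rw [mul_add, map_add, ha, hb, add_zero]
  | smul r a ha => rw [mul_smul_comm, map_smul, ha, smul_zero]
  | of d =>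
    rw [dot, proj_mul_ofDiagram, lastCoeff_ofDiagram, if_neg]
    intro h
    have h1 := lastCupCap_partner hm ⟨i, by omega⟩ hi
    rw [← h] at h1
    have h2 := Matching.comp_proj_partner_inl {j : Fin k | (j : ℕ) ≠ i} d.toMatching
      (i := ⟨i, by omega⟩) (by simp)
    simp only [MotzkinDiagram.comp, MotzkinDiagram.proj] at h1
    rw [h2, Matching.cupCap_inl] at h1
    split_ifs at h1 <;> simp_all

/-- The coefficient does not see terms with dots in front, so `corner` may be replaced by its
leading projection. -/
theorem lastCoeff_corner_mul (a : MotzkinAlgebra K k x) :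
    lastCoeff x hm (corner k x (m + 2) * a) =
      lastCoeff x hm (proj x {j | (j : ℕ) < m + 2} * a) := by
  have : ∀ l ≤ m + 2, lastCoeff x hm (preCorner k x (m + 2) l * a) =
      lastCoeff x hm (proj x {j | (j : ℕ) < m + 2} * a) := by
    intro l
    induction l with
    | zero => intro _; rfl
    | succ l ih =>
      intro hl
      rw [preCorner, dot, ← proj_mul_preCorner_comm, ← dot, sub_mul, map_sub, mul_assoc,
        lastCoeff_dot_mul hm (by omega), sub_zero, ih (by omega)]
  exact this _ le_rfl

/-- Left multiplication with `cupCap` at `i` forces a top edge from `i` to `i + 1`, whereas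
`lastCupCap` has a vertical edge at every `i < m`. -/
theorem lastCoeff_cornerGen_mul {i : ℕ} (hi : i < m) (a : MotzkinAlgebra K k x) :
    lastCoeff x hm (cornerGen k x (m + 2) i * a) = 0 := by
  classical
  rw [cornerGen, mul_assoc, mul_assoc, lastCoeff_corner_mul, ← mul_assoc,
    proj_mul_cupCap_comm i _ (by simp; omega) (by simp; omega), mul_assoc]
  generalize proj x _ * _ = b
  have hik : i + 1 < k := by omega
  rw [cupCap, dif_pos hik]
  induction b using induction_on with
  | zero => simp
  | add a b ha hb => rw [mul_add, map_add, ha, hb, add_zero]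
  | smul r a ha => rw [mul_smul_comm, map_smul, ha, smul_zero]
  | of d =>
    rw [ofDiagram_mul, map_smul, lastCoeff_ofDiagram, if_neg, smul_zero]
    intro h
    have h1 := lastCupCap_partner hm ⟨i, by omega⟩ (by simp only; omega)
    have h2 : (MotzkinDiagram.comp (MotzkinDiagram.cupCap i hik) d).partner
        (Sum.inl ⟨i, by omega⟩) = Sum.inl ⟨i + 1, hik⟩ :=
      Matching.comp_partner_top (by simp [MotzkinDiagram.cupCap, Matching.cupCap_inl])
    rw [h] at h2
    rw [h2, Matching.cupCap_inl] at h1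
    simp only [Fin.mk.injEq] at h1
    rw [if_neg (by omega), if_neg (by omega)] at h1
    simp at h1

theorem lastCoeff_cornerGen_self : lastCoeff x hm (cornerGen k x (m + 2) m) = 1 := by
  classical
  rw [cornerGen, mul_assoc, lastCoeff_corner_mul, ← lastCoeff_flip]
  simp only [flip_mul, flip_proj, flip_cupCap, flip_corner]
  rw [mul_assoc, lastCoeff_corner_mul, ← proj_mul_cupCap_comm m _ (by simp; omega) (by simp; omega),
    ← mul_assoc, proj_mul_proj, Finset.inter_self, ← ofDiagram_lastCupCap hm, lastCoeff_ofDiagram,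
    if_pos rfl]

/-- The element that Wenzl's recursion would have to divide by `u (m + 1)` is `f * e * f`, with `e`
the last generator; at a zero of `u` it is a nonzero `z` with `z * a * z = 0` for all `a`. -/
theorem not_isSemisimpleRing_of_eq_zero (hm : m + 1 < k) (hu0 : u 0 = 1) (hu1 : u 1 = x - 1)
    (hu : ∀ m, u (m + 2) = (x - 1) * u (m + 1) - u m)
    (hne : ∀ j, 1 ≤ j → j ≤ m → u j ≠ 0) (h0 : u (m + 1) = 0) :
    ¬ IsSemisimpleRing (MotzkinAlgebra K k x) := by
  intro hss
  have TL := isTemperleyLieb_corner (k := k) (x := x) (n := m + 2) hm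
  have H := TL.jonesWenzlProperties hu0 hu1 hu m (by omega) hne
  have hφ := TL.functional_jonesWenzl (u := u) m (by omega) (lastCoeff x hm)
    (fun i hi a => lastCoeff_cornerGen_mul hm hi a) (fun i hi a => by
      rw [← lastCoeff_flip, flip_mul, flip_cornerGen, lastCoeff_cornerGen_mul hm hi])
  have hf := flip_jw (k := k) (x := x) u (m + 2) (m + 1)
  rw [jw] at hf
  have E := H.gen_mul_gen (by omega)
  rw [h0, zero_div, zero_smul] at E
  have base : m = 0 → jonesWenzl u (corner k x (m + 2)) (cornerGen k x (m + 2)) (m + 1) =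
      corner k x (m + 2) := by
    rintro rfl
    rfl
  generalize jonesWenzl u (corner k x (m + 2)) (cornerGen k x (m + 2)) (m + 1) = f at *
  generalize jonesWenzl u (corner k x (m + 2)) (cornerGen k x (m + 2)) m = g at *
  have hem : cornerGen k x (m + 2) m * corner k x (m + 2) = cornerGen k x (m + 2) m :=
    TL.mul_unit m (by omega)
  set z := f * cornerGen k x (m + 2) m * f with hz
  have hzQ : z * corner k x (m + 2) = z := by rw [hz, mul_assoc, H.mul_unit]
  have hzf : flip z = z := by
    rw [hz, flip_mul, flip_mul, hf, flip_cornerGen, mul_assoc]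
  have hQz : corner k x (m + 2) * z = z := by
    rw [← flip_flip (_ * z), flip_mul, hzf, flip_corner, hzQ, hzf]
  have hzz : z * z = 0 := by
    calc z * z = f * (cornerGen k x (m + 2) m * (f * f) * cornerGen k x (m + 2) m) * f := by
          rw [hz]; noncomm_ring
      _ = 0 := by rw [H.mul_self, E]; simp
  have hze : ∀ i, i + 1 < m + 2 → z * cornerGen k x (m + 2) i = 0 := by
    intro i hi
    rcases Nat.lt_succ_iff_lt_or_eq.1 (Nat.lt_of_succ_lt_succ hi) with hi | rfl
    · rw [hz, mul_assoc, H.mul_gen i hi, mul_zero]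
    · rw [hz, mul_assoc, mul_assoc, ← mul_assoc (cornerGen k x (i + 2) i), E, mul_zero]
  have hzc : ∀ i, i + 1 < m + 2 → z * (cupCap k x i * dot k x i) = 0 := by
    intro i hi
    -- For `x = 1` the dotted cups cannot be reached by dividing by `x - 1`. Then `m = 0`, so `z` is
    -- the generator itself, whose product with the dotted cup carries the factor `x - 1 = 0`.
    by_cases hx : x - 1 = 0
    · have hm0 : m = 0 := by
        by_contra hm0
        exact hne 1 le_rfl (by omega) (hu1.trans hx)
      have hi0 : i = m := by omega
      rw [hz, base hm0, TL.unit_mul m (by omega), hem, hi0]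
      have := mul_cornerGen_mul (k := k) (x := x) (n := m + 2) (i := m) (by omega)
        corner_mul_corner
      rwa [hx, zero_smul, TL.unit_mul m (by omega)] at this
    · have h1 := mul_cornerGen_mul hi hzQ
      rw [hze i hi, zero_mul] at h1
      exact (smul_eq_zero.1 h1.symm).resolve_left hx
  have hzaz : ∀ a, z * a * z = 0 := by
    intro a
    induction a using induction_on with
    | zero => simp
    | add a b ha hb => rw [mul_add, add_mul, ha, hb, add_zero]
    | smul r a ha => rw [mul_smul_comm, smul_mul_assoc, ha, smul_zero]
    | of d =>
      rcases mul_ofDiagram_mul (r := m + 2) (s := m + 2) hm hm hzQ hQz hzc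
        (fun i hi => dot_mul_cupCap_mul_eq_zero hzf (hzc i hi)) d with h | ⟨-, h⟩
      · exact h
      · rw [h, hzz]
  have hz0 := eq_zero_of_mul_mul_eq_zero hzaz
  -- The functional vanishes on the ideals generated on either side by the first `m` generators, so
  -- both factors `f` may be replaced by the unit of the corner.
  have h1 : lastCoeff x hm z = 1 := by
    rw [hz, mul_assoc, (hφ _).1, ← mul_assoc, TL.unit_mul m (by omega), (hφ _).2, hem,
      lastCoeff_cornerGen_self]
  rw [hz0, map_zero] at h1
  exact zero_ne_one h1

end semisimple

end MotzkinAlgebra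

theorem mainTheorem2 {K : Type*} [Field K] (k : ℕ) (x : K) :
    IsSemisimpleRing (MotzkinAlgebra K k x) ↔
      ∀ j : ℕ, 1 ≤ j → j ≤ k - 1 →
        (Polynomial.Chebyshev.S K (j : ℤ)).eval (x - 1) ≠ 0 := by
  let u : ℕ → K := fun j => (Polynomial.Chebyshev.S K (j : ℤ)).eval (x - 1)
  have hu0 : u 0 = 1 := by simp [u]
  have hu1 : u 1 = x - 1 := by simp [u]
  have hu : ∀ m, u (m + 2) = (x - 1) * u (m + 1) - u m := by
    intro m
    simp only [u]
    push_cast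
    rw [Polynomial.Chebyshev.S_add_two]
    simp
  constructor
  · intro hss
    by_contra hcon
    push Not at hcon
    classical
    -- The least zero is taken, so that the Jones–Wenzl elements before it exist.
    obtain ⟨h1, h2, h3⟩ := Nat.find_spec hcon
    obtain ⟨m, hm⟩ : ∃ m, Nat.find hcon = m + 1 := ⟨Nat.find hcon - 1, by omega⟩
    refine MotzkinAlgebra.not_isSemisimpleRing_of_eq_zero (u := u) (m := m) (by omega) hu0 hu1 hu
      (fun j hj hj' h => ?_) (by rw [← hm]; exact h3) hss
    exact Nat.find_min hcon (m := j) (by omega) ⟨hj, by omega, h⟩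
  · exact MotzkinAlgebra.isSemisimpleRing_of_ne_zero (u := u) hu0 hu1 hu
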